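/- Pick's formula. Let $P$ be a simple (Jordan) lattice polygon, that is, a closed polygonal path in $\mathbb{R}^2$ with at least three nondegenerate sides and all vertices in $\mathbb{Z}^2$, such that consecutive sides meet only in their common endpoint and any two other sides are disjoint. Let $N^b(P)$ be the number of points of $\mathbb{Z}^2$ on the boundary curve $P$, let $N^i(P)$ be the number of points of $\mathbb{Z}^2$ strictly inside, i.e. lying in a bounded connected component of the complement of the curve, and let $A(P)$ be the area of the region consisting of the curve and the points it encloses. Then these numbers are finite and $$A(P) = \tfrac{1}{2} N^b(P) + N^i(P) - 1 .$$ -/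

import Mathlib

open MeasureTheory

namespace LatticePolygon

/-- The integer lattice `ℤ²`, as a set of points of the plane `ℝ²`. -/
def lattice : Set (ℝ × ℝ) :=
  Set.range fun z : ℤ × ℤ => ((z.1 : ℝ), (z.2 : ℝ))

/-- A lattice polygon: all members of its cyclic sequence of vertices are lattice points.
(The sides may carry further lattice points, and consecutive sides may be aligned.) -/
def IsLattice {n : ℕ} (P : Polygon (ℝ × ℝ) n) : Prop :=
  ∀ i, P i ∈ lattice

/-- A simple (Jordan) polygon: a closed polygonal path with at least three sides, all of them
nondegenerate closed segments, in which consecutive sides share only their common endpoint and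
any two other distinct sides are disjoint. The `i`-th side joins the `i`-th vertex to the
cyclically next one, whose index is `finRotate n i`. -/
structure IsSimple {n : ℕ} (P : Polygon (ℝ × ℝ) n) : Prop where
  three_le : 3 ≤ n
  nondegenerate : P.HasNondegenerateEdges
  inter_next : ∀ i, P.edgeSet ℝ i ∩ P.edgeSet ℝ (finRotate n i) = {P (finRotate n i)}
  disjoint : ∀ i j, i ≠ j → j ≠ finRotate n i → i ≠ finRotate n j →
    Disjoint (P.edgeSet ℝ i) (P.edgeSet ℝ j)

/-- The points enclosed by `P`: those off the boundary curve whose connected component in the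
complement of the boundary curve is bounded. -/
def inside {n : ℕ} (P : Polygon (ℝ × ℝ) n) : Set (ℝ × ℝ) :=
  {x | x ∉ P.boundary ℝ ∧ Bornology.IsBounded (connectedComponentIn (P.boundary ℝ)ᶜ x)}

/-- The closed region bounded by `P`: the boundary curve with the points that it encloses. -/
def region {n : ℕ} (P : Polygon (ℝ × ℝ) n) : Set (ℝ × ℝ) :=
  P.boundary ℝ ∪ inside P

/-- The lattice points on the boundary. -/
def boundaryPoints {n : ℕ} (P : Polygon (ℝ × ℝ) n) : Set (ℝ × ℝ) :=
  lattice ∩ P.boundary ℝ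

/-- The lattice points strictly inside. -/
def interiorPoints {n : ℕ} (P : Polygon (ℝ × ℝ) n) : Set (ℝ × ℝ) :=
  lattice ∩ inside P

/-- The area `A(P)`: the Lebesgue measure of the region bounded by `P`. -/
noncomputable def area {n : ℕ} (P : Polygon (ℝ × ℝ) n) : ℝ :=
  volume.real (region P)

/-- `N^b(P)`. -/
noncomputable def numBoundary {n : ℕ} (P : Polygon (ℝ × ℝ) n) : ℕ :=
  (boundaryPoints P).ncard

/-- `N^i(P)`. -/
noncomputable def numInterior {n : ℕ} (P : Polygon (ℝ × ℝ) n) : ℕ :=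
  (interiorPoints P).ncard

end LatticePolygon

/-! ### Winding numbers by counting crossings with a vertical ray -/

namespace LatticePolygon
open Filter Topology Set

/-! Call area minus half the boundary points minus the interior points plus one the defect of a
closed curve (`pickDefect`). Pick's formula says that it vanishes. The proof is an induction on the
number of sides: a simple lattice polygon with at least four sides has a chord between two vertices
that meets the curve only at its ends (`SimpleChain.exists_chord`), the chord yields two simple
lattice polygons with fewer sides, and the defects of the three curves satisfy an additive relation.
Triangles are the base case.

The additivity needs the Jordan curve theorem for polygons (`SimpleChain.jordan`). The winding
number `wind` counts signed crossings with an upward vertical ray. It is locally constant off the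
curve, zero far away, and jumps by one across a nonvertical side. On the other hand there are at
most two components: every component reaches the curve, hence contains the points just beside some
side, on its left or on its right, and following the curve around its vertices carries this to all
sides. So there are exactly two components, and the enclosed points are those of nonzero winding
number, which is a constant sign.

The two polygons cut off by a chord traverse it in opposite directions, so their winding numbers add
up to that of the original polygon. All three take only the value zero and one sign each, and this
forces one of the three curves to enclose the disjoint union of what the other two enclose, up to
the arc common to those two. Whether the chord runs inside or outside never has to be decided: if
the defects of two of the three curves vanish, so does the third (`pickDefect_theta`,
`SimpleChain.pickDefect_eq_zero_of_chord`).

For a triangle, the half-open parallelogram spanned by two sides is a fundamental domain of a group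
of lattice translations, and so is the union of the unit squares attached to its lattice points;
hence its area is its number of lattice points. A half turn splits the parallelogram into two
congruent triangles and boundary points, which gives the formula (`AffineCoords.pickDefect_sides`).
-/

/-- The planar cross product. -/
def cross (d e : ℝ × ℝ) : ℝ := d.1 * e.2 - d.2 * e.1

/-- The horizontal half-line indicator `[v.1 ≤ x.1]`. -/
noncomputable def rightOf (v x : ℝ × ℝ) : ℤ := if v.1 ≤ x.1 then 1 else 0

/-- The point `x` is strictly below the (nonvertical) line through `p` and `q`. -/
def IsBelow (p q x : ℝ × ℝ) : Prop :=
  x.2 * (q.1 - p.1) ^ 2 < ((q.1 - x.1) * p.2 + (x.1 - p.1) * q.2) * (q.1 - p.1)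

open Classical in
/-- The signed number of crossings of the segment from `p` to `q` with the upward vertical ray
from `x`. -/
noncomputable def crossing (p q x : ℝ × ℝ) : ℤ :=
  (rightOf p x - rightOf q x) * if IsBelow p q x then 1 else 0

theorem isBelow_comm (p q x : ℝ × ℝ) : IsBelow p q x ↔ IsBelow q p x := by
  unfold IsBelow
  constructor <;> intro h <;> linarith

theorem crossing_swap (p q x : ℝ × ℝ) : crossing q p x = -crossing p q x := by
  unfold crossing
  by_cases h : IsBelow p q x
  · rw [if_pos h, if_pos ((isBelow_comm p q x).1 h)]; ring
  · rw [if_neg h, if_neg fun h' => h ((isBelow_comm p q x).2 h')]; ring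

theorem mem_segment_iff_exists {p q x : ℝ × ℝ} :
    x ∈ segment ℝ p q ↔ ∃ t ∈ Icc (0 : ℝ) 1, x = p + t • (q - p) := by
  rw [segment_eq_image']
  constructor
  · rintro ⟨t, ht, rfl⟩; exact ⟨t, ht, rfl⟩
  · rintro ⟨t, ht, rfl⟩; exact ⟨t, ht, rfl⟩

theorem isClosed_segment (p q : ℝ × ℝ) : IsClosed (segment ℝ p q) := by
  rw [segment_eq_image']
  exact (isCompact_Icc.image (by fun_prop)).isClosed

theorem mem_segment_of_on_line {p q x : ℝ × ℝ} (hpq : p.1 ≠ q.1)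
    (hx : (p.1 ≤ x.1 ∧ x.1 ≤ q.1) ∨ (q.1 ≤ x.1 ∧ x.1 ≤ p.1))
    (h : x.2 * (q.1 - p.1) ^ 2 = ((q.1 - x.1) * p.2 + (x.1 - p.1) * q.2) * (q.1 - p.1)) :
    x ∈ segment ℝ p q := by
  have hD : q.1 - p.1 ≠ 0 := sub_ne_zero.2 hpq.symm
  have h' : x.2 * (q.1 - p.1) = (q.1 - x.1) * p.2 + (x.1 - p.1) * q.2 := by
    apply mul_right_cancel₀ hD; linarith
  refine mem_segment_iff_exists.2 ⟨(x.1 - p.1) / (q.1 - p.1), ?_, ?_⟩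
  · rcases hx with ⟨h1, h2⟩ | ⟨h1, h2⟩
    · have : 0 < q.1 - p.1 := lt_of_le_of_ne (by linarith) hD.symm
      exact ⟨div_nonneg (by linarith) this.le, (div_le_one this).2 (by linarith)⟩
    · have : q.1 - p.1 < 0 := lt_of_le_of_ne (by linarith) hD
      exact ⟨div_nonneg_of_nonpos (by linarith) this.le, (div_le_one_of_neg this).2 (by linarith)⟩
  · ext
    · simp; field_simp; ring
    · simp; field_simp; linarith

theorem mem_segment_of_vertical {p q x : ℝ × ℝ} (hp : p.1 = x.1) (hq : q.1 = x.1)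
    (hx : (p.2 ≤ x.2 ∧ x.2 ≤ q.2) ∨ (q.2 ≤ x.2 ∧ x.2 ≤ p.2)) :
    x ∈ segment ℝ p q := by
  have : x.2 ∈ segment ℝ p.2 q.2 := by
    rw [segment_eq_uIcc, mem_uIcc]; exact hx
  have hx' : x = (x.1, x.2) := rfl
  have hp' : p = (x.1, p.2) := by rw [← hp]
  have hq' : q = (x.1, q.2) := by rw [← hq]
  rw [hx', hp', hq', ← Prod.image_mk_segment_right]
  exact ⟨x.2, this, rfl⟩

theorem eventually_rightOf_eq {v x : ℝ × ℝ} (h : v.1 ≠ x.1) :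
    ∀ᶠ y in 𝓝 x, rightOf v y = rightOf v x := by
  have hc : Tendsto (fun y : ℝ × ℝ => y.1) (𝓝 x) (𝓝 x.1) := continuous_fst.continuousAt
  rcases lt_or_gt_of_ne h with h | h
  · filter_upwards [hc.eventually (lt_mem_nhds h)] with y hy
    simp [rightOf, hy.le, h.le]
  · filter_upwards [hc.eventually (gt_mem_nhds h)] with y hy
    simp [rightOf, not_le.2 hy, not_le.2 h]

theorem eventually_isBelow_iff {p q x : ℝ × ℝ}
    (h : x.2 * (q.1 - p.1) ^ 2 ≠ ((q.1 - x.1) * p.2 + (x.1 - p.1) * q.2) * (q.1 - p.1)) :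
    ∀ᶠ y in 𝓝 x, (IsBelow p q y ↔ IsBelow p q x) := by
  unfold IsBelow
  have hc : Tendsto (fun y : ℝ × ℝ => y.2 * (q.1 - p.1) ^ 2 -
      ((q.1 - y.1) * p.2 + (y.1 - p.1) * q.2) * (q.1 - p.1)) (𝓝 x) (𝓝 (x.2 * (q.1 - p.1) ^ 2 -
      ((q.1 - x.1) * p.2 + (x.1 - p.1) * q.2) * (q.1 - p.1))) :=
    Continuous.continuousAt (by fun_prop)
  rcases lt_or_gt_of_ne h with h | h
  · filter_upwards [hc.eventually (gt_mem_nhds (sub_neg.2 h))] with y hy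
    exact ⟨fun _ => h, fun _ => by linarith⟩
  · filter_upwards [hc.eventually (lt_mem_nhds (sub_pos.2 h))] with y hy
    exact ⟨fun h' => absurd h' (by linarith), fun h' => absurd h' (by linarith)⟩

open Classical in
/-- The local correction at `x₀` coming from a vertex `v` straight above `x₀`. -/
noncomputable def upperJump (x₀ v x : ℝ × ℝ) : ℤ :=
  if v.1 = x₀.1 ∧ x₀.2 < v.2 then rightOf v x else 0

/-- The crossing number of one side is not locally constant off that side: it changes when the ray
sweeps over an endpoint straight above. The change is a difference of one function taken at the two
endpoints, so it cancels around a closed chain. -/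
theorem eventually_crossing_eq {p q x : ℝ × ℝ} (hx : x ∉ segment ℝ p q) :
    ∀ᶠ y in 𝓝 x, crossing p q y - crossing p q x =
      (upperJump x p y - upperJump x p x) - (upperJump x q y - upperJump x q x) := by
  by_cases hpq : p.1 = q.1
  · have hc : ∀ y, crossing p q y = 0 := fun y => by simp [crossing, rightOf, hpq]
    by_cases hp : p.1 = x.1
    · have hq : q.1 = x.1 := hpq ▸ hp
      have : x.2 < p.2 ↔ x.2 < q.2 := by
        constructor <;> intro h <;> by_contra h' <;> push Not at h'
        · exact hx (mem_segment_of_vertical hp hq (Or.inr ⟨h', h.le⟩))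
        · exact hx (mem_segment_of_vertical hp hq (Or.inl ⟨h', h.le⟩))
      refine Eventually.of_forall fun y => ?_
      simp [hc, upperJump, hp, hq, this, rightOf]
    · have hq : q.1 ≠ x.1 := hpq ▸ hp
      refine Eventually.of_forall fun y => ?_
      simp [hc, upperJump, hp, hq]
  -- In the closed vertical strip over the side, a point off the side is off its whole line, so
  -- `IsBelow` is locally constant. Outside the strip both values of `rightOf` agree, and no
  -- crossing occurs.
  by_cases hin : (p.1 ≤ x.1 ∧ x.1 ≤ q.1) ∨ (q.1 ≤ x.1 ∧ x.1 ≤ p.1)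
  · have hne := fun h => hx (mem_segment_of_on_line hpq hin h)
    have hb := eventually_isBelow_iff hne
    by_cases hp : p.1 = x.1
    · have hq : q.1 ≠ x.1 := fun h => hpq (hp.trans h.symm)
      have hbp : IsBelow p q x ↔ x.2 < p.2 := by
        have : 0 < (q.1 - p.1) ^ 2 := by
          have := sub_ne_zero.2 hpq; have := sub_ne_zero.2 (Ne.symm hpq); positivity
        unfold IsBelow
        rw [hp] at this ⊢
        rw [show ((q.1 - x.1) * p.2 + (x.1 - x.1) * q.2) * (q.1 - x.1) = p.2 * (q.1 - x.1) ^ 2 by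
          ring]
        exact mul_lt_mul_iff_of_pos_right this
      filter_upwards [hb, eventually_rightOf_eq hq] with y hy hqy
      simp only [crossing, hy, hqy, upperJump, hp, hq, hbp, true_and, false_and, if_false]
      split_ifs <;> ring
    · by_cases hq : q.1 = x.1
      · have hbq : IsBelow p q x ↔ x.2 < q.2 := by
          have : 0 < (q.1 - p.1) ^ 2 := by
            have := sub_ne_zero.2 hpq; have := sub_ne_zero.2 (Ne.symm hpq); positivity
          unfold IsBelow
          rw [hq] at this ⊢
          rw [show ((x.1 - x.1) * p.2 + (x.1 - p.1) * q.2) * (x.1 - p.1) = q.2 * (x.1 - p.1) ^ 2 by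
            ring]
          exact mul_lt_mul_iff_of_pos_right this
        filter_upwards [hb, eventually_rightOf_eq hp] with y hy hpy
        simp only [crossing, hy, hpy, upperJump, hp, hq, hbq, true_and, false_and, if_false]
        split_ifs <;> ring
      · filter_upwards [hb, eventually_rightOf_eq hp, eventually_rightOf_eq hq] with y hy hpy hqy
        by_cases hbx : IsBelow p q x
        · simp [crossing, hy.2 hbx, hbx, hpy, hqy, upperJump, hp, hq]
        · simp [crossing, mt hy.1 hbx, hbx, upperJump, hp, hq]
  · push Not at hin
    have hp : p.1 ≠ x.1 := by
      rintro h
      rcases le_total p.1 q.1 with h' | h'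
      · linarith [hin.1 h.le]
      · linarith [hin.2 (by linarith)]
    have hq : q.1 ≠ x.1 := by
      rintro h
      rcases le_total p.1 q.1 with h' | h'
      · linarith [hin.1 (by linarith)]
      · linarith [hin.2 h.le]
    have hr : rightOf p x = rightOf q x := by
      unfold rightOf
      split_ifs with h1 h2 h2
      · rfl
      · exact absurd (hin.1 h1) (by linarith)
      · exact absurd (hin.2 h2) (by linarith)
      · rfl
    filter_upwards [eventually_rightOf_eq hp, eventually_rightOf_eq hq] with y hpy hqy
    simp [crossing, hpy, hqy, hr, upperJump, hp, hq]

/-- A closed polygonal chain, as an `n`-periodic sequence of vertices, that is simple. -/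
structure SimpleChain (n : ℕ) (f : ℕ → ℝ × ℝ) : Prop where
  three_le : 3 ≤ n
  periodic : ∀ i, f (i + n) = f i
  ne : ∀ i, f i ≠ f (i + 1)
  inter : ∀ i j x, i < j → j < i + n → x ∈ segment ℝ (f i) (f (i + 1)) →
    x ∈ segment ℝ (f j) (f (j + 1)) → (j = i + 1 ∧ x = f j) ∨ (j + 1 = i + n ∧ x = f i)

/-- The union of the sides of a chain. -/
def trace (f : ℕ → ℝ × ℝ) : Set (ℝ × ℝ) := ⋃ i, segment ℝ (f i) (f (i + 1))

/-- The winding number, computed by counting crossings of a vertical ray. -/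
noncomputable def wind (n : ℕ) (f : ℕ → ℝ × ℝ) (x : ℝ × ℝ) : ℤ :=
  ∑ i ∈ Finset.range n, crossing (f i) (f (i + 1)) x

variable {n : ℕ} {f : ℕ → ℝ × ℝ}

theorem segment_subset_trace (f : ℕ → ℝ × ℝ) (i : ℕ) :
    segment ℝ (f i) (f (i + 1)) ⊆ trace f := subset_iUnion_of_subset i subset_rfl

theorem vertex_mem_trace (f : ℕ → ℝ × ℝ) (i : ℕ) : f i ∈ trace f :=
  segment_subset_trace f i (left_mem_segment _ _ _)

theorem apply_mod_of_periodic (h : ∀ i, f (i + n) = f i) (i : ℕ) : f (i % n) = f i :=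
  Function.Periodic.map_mod_nat (f := f) h i

theorem apply_mod_succ_of_periodic (h : ∀ i, f (i + n) = f i) (i : ℕ) :
    f (i % n + 1) = f (i + 1) := by
  rw [← apply_mod_of_periodic h (i % n + 1), ← apply_mod_of_periodic h (i + 1), Nat.mod_add_mod]

theorem exists_lt_of_mem_trace (h : ∀ i, f (i + n) = f i) (hn : 0 < n) (m : ℕ) {x : ℝ × ℝ}
    (hx : x ∈ trace f) : ∃ i, m ≤ i ∧ i < m + n ∧ x ∈ segment ℝ (f i) (f (i + 1)) := by
  obtain ⟨j, hj⟩ := mem_iUnion.1 hx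
  have key : ∃ i, m ≤ i ∧ i < m + n ∧ i % n = j % n := by
    -- The index congruent to `j` in the window starting at `m`; adding `n - m % n` replaces
    -- subtracting `m`, which would truncate.
    refine ⟨m + (j + (n - m % n)) % n, by omega, by have := Nat.mod_lt (j + (n - m % n)) hn; omega, ?_⟩
    have hm := Nat.mod_lt m hn
    rw [Nat.add_mod_mod, ← Nat.mod_add_mod, show m % n + (j + (n - m % n)) = j + n by omega]
    simp
  obtain ⟨i, h1, h2, h3⟩ := key
  refine ⟨i, h1, h2, ?_⟩
  rwa [← apply_mod_of_periodic h i, ← apply_mod_succ_of_periodic h i, h3,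
    apply_mod_of_periodic h, apply_mod_succ_of_periodic h]

theorem trace_eq_biUnion (h : ∀ i, f (i + n) = f i) (hn : 0 < n) :
    trace f = ⋃ i ∈ Finset.range n, segment ℝ (f i) (f (i + 1)) := by
  ext x
  constructor
  · intro hx
    obtain ⟨i, -, h2, h3⟩ := exists_lt_of_mem_trace h hn 0 hx
    simp only [mem_iUnion, Finset.mem_range]
    exact ⟨i, by omega, h3⟩
  · intro hx
    simp only [mem_iUnion] at hx
    obtain ⟨i, -, h3⟩ := hx
    exact segment_subset_trace f i h3

theorem isCompact_segment (p q : ℝ × ℝ) : IsCompact (segment ℝ p q) := by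
  rw [segment_eq_image']
  exact isCompact_Icc.image (by fun_prop)

theorem isCompact_trace (h : ∀ i, f (i + n) = f i) (hn : 0 < n) : IsCompact (trace f) := by
  rw [trace_eq_biUnion h hn]
  exact (Finset.range n).isCompact_biUnion fun i _ => isCompact_segment _ _

theorem sum_telescope (h : ∀ i, f (i + n) = f i) (g : ℝ × ℝ → ℤ) :
    ∑ i ∈ Finset.range n, (g (f i) - g (f (i + 1))) = 0 := by
  have := h 0
  rw [Nat.zero_add] at this
  rw [Finset.sum_range_sub' (fun i => g (f i)), this, sub_self]

theorem eventually_wind_eq (h : ∀ i, f (i + n) = f i) {x : ℝ × ℝ} (hx : x ∉ trace f) :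
    ∀ᶠ y in 𝓝 x, wind n f y = wind n f x := by
  have : ∀ᶠ y in 𝓝 x, ∀ i ∈ Finset.range n,
      crossing (f i) (f (i + 1)) y - crossing (f i) (f (i + 1)) x =
      (upperJump x (f i) y - upperJump x (f i) x) -
        (upperJump x (f (i + 1)) y - upperJump x (f (i + 1)) x) :=
    (Filter.eventually_all_finset _).2 fun i _ =>
      eventually_crossing_eq fun hi => hx (segment_subset_trace f i hi)
  filter_upwards [this] with y hy
  rw [← sub_eq_zero, wind, wind, ← Finset.sum_sub_distrib, Finset.sum_congr rfl hy]
  exact sum_telescope h fun v => upperJump x v y - upperJump x v x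

/-- The norm is the maximum norm, so the point misses a box containing the vertices. To the left or
right of the box `rightOf` is constant on the vertices; above it no side is crossed; below it
`IsBelow` holds for every side that spans the ray, and the signs telescope. -/
theorem wind_eq_zero_of_far (h : ∀ i, f (i + n) = f i) {R : ℝ} (hR : ∀ i, ‖f i‖ ≤ R)
    {x : ℝ × ℝ} (hx : R < ‖x‖) : wind n f x = 0 := by
  have h1 : ∀ i, |(f i).1| ≤ R := fun i => (norm_fst_le (f i)).trans (hR i)
  have h2 : ∀ i, |(f i).2| ≤ R := fun i => (norm_snd_le (f i)).trans (hR i)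
  have hz : ∀ i, rightOf (f i) x = rightOf (f (i + 1)) x → crossing (f i) (f (i + 1)) x = 0 := by
    intro i hi; simp [crossing, hi]
  rw [Prod.norm_def, lt_max_iff, Real.norm_eq_abs, Real.norm_eq_abs, lt_abs, lt_abs] at hx
  rcases hx with (hx | hx) | hx
  · refine Finset.sum_eq_zero fun i _ => hz i ?_
    have a := abs_le.1 (h1 i); have b := abs_le.1 (h1 (i + 1))
    simp [rightOf, show (f i).1 ≤ x.1 by linarith, show (f (i + 1)).1 ≤ x.1 by linarith]
  · refine Finset.sum_eq_zero fun i _ => hz i ?_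
    have a := abs_le.1 (h1 i); have b := abs_le.1 (h1 (i + 1))
    simp [rightOf, show ¬ (f i).1 ≤ x.1 by linarith, show ¬ (f (i + 1)).1 ≤ x.1 by linarith]
  -- `t` and `u` are the barycentric weights of `x.1` between the endpoints, scaled by the squared
  -- width, so that `IsBelow` compares `x.2 * (t + u)` with a nonnegative combination of the
  -- endpoint heights.
  have key : ∀ i, rightOf (f i) x ≠ rightOf (f (i + 1)) x →
      ∃ t u : ℝ, 0 ≤ t ∧ 0 ≤ u ∧ 0 < t + u ∧
        ((f (i + 1)).1 - x.1) * ((f (i + 1)).1 - (f i).1) = t ∧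
        (x.1 - (f i).1) * ((f (i + 1)).1 - (f i).1) = u := by
    intro i hi
    refine ⟨_, _, ?_, ?_, ?_, rfl, rfl⟩ <;> unfold rightOf at hi <;> split_ifs at hi with a b b <;>
      first | exact absurd rfl hi | skip
    all_goals push Not at *
    all_goals nlinarith
  rcases hx with hx | hx
  · refine Finset.sum_eq_zero fun i _ => ?_
    by_cases hi : rightOf (f i) x = rightOf (f (i + 1)) x
    · exact hz i hi
    obtain ⟨t, u, ht, hu, htu, et, eu⟩ := key i hi
    have a := abs_le.1 (h2 i); have b := abs_le.1 (h2 (i + 1))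
    have : ¬ IsBelow (f i) (f (i + 1)) x := by
      unfold IsBelow
      have e1 : x.2 * ((f (i + 1)).1 - (f i).1) ^ 2 = x.2 * (t + u) := by rw [← et, ← eu]; ring
      have e2 : (((f (i + 1)).1 - x.1) * (f i).2 + (x.1 - (f i).1) * (f (i + 1)).2) *
        ((f (i + 1)).1 - (f i).1) = t * (f i).2 + u * (f (i + 1)).2 := by rw [← et, ← eu]; ring
      rw [e1, e2]
      nlinarith
    simp [crossing, this]
  · rw [wind, ← sum_telescope h fun v => rightOf v x]
    refine Finset.sum_congr rfl fun i _ => ?_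
    by_cases hi : rightOf (f i) x = rightOf (f (i + 1)) x
    · rw [hz i hi, hi, sub_self]
    obtain ⟨t, u, ht, hu, htu, et, eu⟩ := key i hi
    have a := abs_le.1 (h2 i); have b := abs_le.1 (h2 (i + 1))
    have : IsBelow (f i) (f (i + 1)) x := by
      unfold IsBelow
      have e1 : x.2 * ((f (i + 1)).1 - (f i).1) ^ 2 = x.2 * (t + u) := by rw [← et, ← eu]; ring
      have e2 : (((f (i + 1)).1 - x.1) * (f i).2 + (x.1 - (f i).1) * (f (i + 1)).2) *
        ((f (i + 1)).1 - (f i).1) = t * (f i).2 + u * (f (i + 1)).2 := by rw [← et, ← eu]; ring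
      rw [e1, e2]
      nlinarith
    simp [crossing, this]

theorem exists_norm_le_of_periodic (h : ∀ i, f (i + n) = f i) (hn : 0 < n) :
    ∃ R, ∀ x ∈ trace f, ‖x‖ ≤ R :=
  (isCompact_trace h hn).isBounded.exists_norm_le

end LatticePolygon

/-! ### The two sectors at a boundary point -/

namespace LatticePolygon
open Filter Topology Set
variable {n : ℕ} {f : ℕ → ℝ × ℝ}

/-- The vector `d` rotated by a quarter turn. -/
def perp (d : ℝ × ℝ) : ℝ × ℝ := (-d.2, d.1)

theorem exists_smul_eq_of_cross_eq_zero {d y : ℝ × ℝ} (hd : d ≠ 0) (h : cross d y = 0) :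
    ∃ c : ℝ, y = c • d := by
  unfold cross at h
  by_cases h1 : d.1 = 0
  · have h2 : d.2 ≠ 0 := fun h2 => hd (Prod.ext h1 h2)
    have : y.1 = 0 := by
      rw [h1] at h
      have : d.2 * y.1 = 0 := by linarith
      exact (mul_eq_zero.1 this).resolve_left h2
    exact ⟨y.2 / d.2, by ext <;> simp [h1, this, h2]⟩
  · refine ⟨y.1 / d.1, ?_⟩
    ext
    · simp [h1]
    · simp; field_simp; linarith

/-- The directions `d` and `e` of two consecutive sides: the second does not fold back. -/
def Unfolded (d e : ℝ × ℝ) : Prop :=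
  d ≠ 0 ∧ e ≠ 0 ∧ (cross d e = 0 → ∃ c : ℝ, 0 < c ∧ e = c • d)

/-- Near `v`, the set `B` consists of the rays from `v` in directions `-d` and `e`. -/
def LocalRays (B : Set (ℝ × ℝ)) (v d e : ℝ × ℝ) : Prop :=
  ∀ᶠ y in 𝓝 (0 : ℝ × ℝ), v + y ∈ B ↔ (∃ a : ℝ, 0 ≤ a ∧ y = -(a • d)) ∨ ∃ b : ℝ, 0 ≤ b ∧ y = b • e

/-- The open sector to the left (`s = 1`) or right (`s = -1`) of the path that comes in with
direction `d` and leaves with direction `e`. -/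
def InSector (s : ℝ) (d e y : ℝ × ℝ) : Prop :=
  (0 < s * cross d e ∧ 0 < s * cross d y ∧ 0 < s * cross e y) ∨
    (s * cross d e ≤ 0 ∧ (0 < s * cross d y ∨ 0 < s * cross e y))

theorem InSector.not_ray {s : ℝ} {d e y : ℝ × ℝ} (h : InSector s d e y) :
    ¬ ((∃ a : ℝ, 0 ≤ a ∧ y = -(a • d)) ∨ ∃ b : ℝ, 0 ≤ b ∧ y = b • e) := by
  rintro (⟨a, ha, rfl⟩ | ⟨b, hb, rfl⟩) <;> rcases h with ⟨h1, h2, h3⟩ | ⟨h1, h2 | h2⟩ <;>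
    simp only [cross, Prod.fst_neg, Prod.snd_neg, Prod.smul_fst, Prod.smul_snd, smul_eq_mul] at * <;>
    nlinarith

/-- A case check on the signs of `cross d e`, `cross d y` and `cross e y`. When one of the last two
vanishes, `y` lies on the line of a ray but not on the ray, hence on the opposite half-line, and the
sign of `cross d e` fixes its sector. -/
theorem inSector_of_not_ray {d e y : ℝ × ℝ} (h : Unfolded d e)
    (hy : ¬ ((∃ a : ℝ, 0 ≤ a ∧ y = -(a • d)) ∨ ∃ b : ℝ, 0 ≤ b ∧ y = b • e)) :
    InSector 1 d e y ∨ InSector (-1) d e y := by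
  obtain ⟨hd, he, hde⟩ := h
  push Not at hy
  obtain ⟨hy1, hy2⟩ := hy
  have k1 : ∀ c : ℝ, y = c • d → 0 < c := fun c hc => by
    by_contra hc'
    exact hy1 (-c) (by linarith) (by simp [hc])
  have k2 : ∀ c : ℝ, y = c • e → c < 0 := fun c hc => by
    by_contra hc'
    exact hy2 c (by linarith) hc
  have cd : ∀ c : ℝ, cross e (c • d) = -c * cross d e := fun c => by simp [cross]; ring
  have ce : ∀ c : ℝ, cross d (c • e) = c * cross d e := fun c => by simp [cross]; ring
  have q1 : cross d y = 0 → ∃ c, 0 < c ∧ cross e y = -c * cross d e := fun h0 => by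
    obtain ⟨c, hc⟩ := exists_smul_eq_of_cross_eq_zero hd h0
    exact ⟨c, k1 c hc, by rw [hc, cd]⟩
  have q2 : cross e y = 0 → ∃ c, c < 0 ∧ cross d y = c * cross d e := fun h0 => by
    obtain ⟨c, hc⟩ := exists_smul_eq_of_cross_eq_zero he h0
    exact ⟨c, k2 c hc, by rw [hc, ce]⟩
  have q3 : cross d e = 0 → cross d y ≠ 0 := fun h0 h1 => by
    obtain ⟨c, hc⟩ := exists_smul_eq_of_cross_eq_zero hd h1
    obtain ⟨l, hl, hel⟩ := hde h0
    have := k2 (c / l) (by rw [hel, hc, smul_smul]; congr 1; field_simp)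
    have h3 := k1 c hc
    have := div_pos h3 hl
    linarith
  unfold InSector
  simp only [one_mul, neg_mul, neg_pos]
  rcases lt_trichotomy (cross d e) 0 with h | h | h
  · rcases lt_trichotomy (cross d y) 0 with h1 | h1 | h1
    · rcases lt_trichotomy (cross e y) 0 with h2 | h2 | h2
      · exact Or.inr (Or.inl ⟨h, h1, h2⟩)
      · obtain ⟨c, hc, hc'⟩ := q2 h2; nlinarith
      · exact Or.inl (Or.inr ⟨h.le, Or.inr h2⟩)
    · obtain ⟨c, hc, hc'⟩ := q1 h1
      exact Or.inl (Or.inr ⟨h.le, Or.inr (by nlinarith)⟩)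
    · exact Or.inl (Or.inr ⟨h.le, Or.inl h1⟩)
  · rcases lt_or_gt_of_ne (q3 h) with h1 | h1
    · exact Or.inr (Or.inr ⟨by linarith, Or.inl h1⟩)
    · exact Or.inl (Or.inr ⟨h.le, Or.inl h1⟩)
  · rcases lt_trichotomy (cross d y) 0 with h1 | h1 | h1
    · exact Or.inr (Or.inr ⟨by linarith, Or.inl h1⟩)
    · obtain ⟨c, hc, hc'⟩ := q1 h1
      exact Or.inr (Or.inr ⟨by linarith, Or.inr (by nlinarith)⟩)
    · rcases lt_trichotomy (cross e y) 0 with h2 | h2 | h2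
      · exact Or.inr (Or.inr ⟨by linarith, Or.inr h2⟩)
      · obtain ⟨c, hc, hc'⟩ := q2 h2; nlinarith
      · exact Or.inl (Or.inl ⟨h, h1, h2⟩)

theorem convex_halfPlane (s : ℝ) (d : ℝ × ℝ) : Convex ℝ {y | 0 < s * cross d y} := by
  refine convex_halfSpace_gt (f := fun y => s * cross d y) ⟨fun x y => ?_, fun c x => ?_⟩ 0
  · simp [cross]; ring
  · simp [cross]; ring

/-- If the path turns towards the side `s`, the sector is an intersection of half-planes, hence
convex. Otherwise it is a union of two half-planes with a common point: `d - e` at a genuine turn,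
the normal `s • perp d` on a straight path. Scaling moves that point into the ball. -/
theorem isPreconnected_ball_inter_sector {s : ℝ} (hs : s ^ 2 = 1) {d e : ℝ × ℝ}
    (h : Unfolded d e) {r : ℝ} (hr : 0 < r) :
    IsPreconnected {y | y ∈ Metric.ball (0 : ℝ × ℝ) r ∧ InSector s d e y} := by
  have hB := convex_ball (0 : ℝ × ℝ) r
  have hd := convex_halfPlane s d
  have he := convex_halfPlane s e
  by_cases hc : 0 < s * cross d e
  · have : {y | y ∈ Metric.ball (0 : ℝ × ℝ) r ∧ InSector s d e y} =
        Metric.ball 0 r ∩ ({y | 0 < s * cross d y} ∩ {y | 0 < s * cross e y}) := by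
      ext y; simp [InSector, hc, not_le.2 hc]
    rw [this]
    exact (hB.inter (hd.inter he)).isPreconnected
  · push Not at hc
    have : {y | y ∈ Metric.ball (0 : ℝ × ℝ) r ∧ InSector s d e y} =
        Metric.ball 0 r ∩ {y | 0 < s * cross d y} ∪ Metric.ball 0 r ∩ {y | 0 < s * cross e y} := by
      ext y; simp [InSector, hc, not_lt.2 hc]; tauto
    rw [this]
    have key : ∃ y : ℝ × ℝ, 0 < s * cross d y ∧ 0 < s * cross e y := by
      rcases hc.lt_or_eq with hc | hc
      · refine ⟨d - e, ?_, ?_⟩ <;> simp only [cross, Prod.fst_sub, Prod.snd_sub] at * <;> nlinarith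
      · have hs0 : s ≠ 0 := by rintro rfl; norm_num at hs
        obtain ⟨l, hl, hel⟩ := h.2.2 ((mul_eq_zero.1 hc).resolve_left hs0)
        have hd0 : 0 < d.1 ^ 2 + d.2 ^ 2 := by
          by_contra h0
          have h1 : d.1 = 0 := by nlinarith [sq_nonneg d.1, sq_nonneg d.2]
          have h2 : d.2 = 0 := by nlinarith [sq_nonneg d.1, sq_nonneg d.2]
          exact h.1 (Prod.ext h1 h2)
        have k1 : s * cross d (s • perp d) = d.1 ^ 2 + d.2 ^ 2 := by
          simp only [cross, perp, Prod.smul_fst, Prod.smul_snd, smul_eq_mul]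
          linear_combination (d.1 ^ 2 + d.2 ^ 2) * hs
        have k2 : s * cross e (s • perp d) = l * (d.1 ^ 2 + d.2 ^ 2) := by
          rw [hel]
          simp only [cross, perp, Prod.smul_fst, Prod.smul_snd, smul_eq_mul]
          linear_combination l * (d.1 ^ 2 + d.2 ^ 2) * hs
        exact ⟨s • perp d, by rw [k1]; exact hd0, by rw [k2]; positivity⟩
    obtain ⟨y, hy1, hy2⟩ := key
    have : ∀ᶠ c in 𝓝[>] (0 : ℝ), c • y ∈ Metric.ball (0 : ℝ × ℝ) r := by
      have ht : Tendsto (fun c : ℝ => c • y) (𝓝[>] 0) (𝓝 0) := by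
        have : Tendsto (fun c : ℝ => c • y) (𝓝 0) (𝓝 ((0 : ℝ) • y)) :=
          Continuous.tendsto (by fun_prop) 0
        rw [zero_smul] at this
        exact this.mono_left nhdsWithin_le_nhds
      exact ht.eventually (Metric.ball_mem_nhds _ hr)
    obtain ⟨c, hcb, hc0⟩ := (this.and self_mem_nhdsWithin).exists
    have hc0 : 0 < c := hc0
    have sc : ∀ d : ℝ × ℝ, s * cross d (c • y) = c * (s * cross d y) := fun d => by
      simp [cross]; ring
    refine (hB.inter hd).isPreconnected.union' ⟨c • y, ⟨hcb, ?_⟩, hcb, ?_⟩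
      (hB.inter he).isPreconnected
    · rw [mem_ofPred_eq, sc]; positivity
    · rw [mem_ofPred_eq, sc]; positivity

/-- `C` absorbs each connected set off `B` that it meets. -/
def Absorbs (B C : Set (ℝ × ℝ)) : Prop :=
  ∀ S : Set (ℝ × ℝ), IsPreconnected S → S ⊆ Bᶜ → (S ∩ C).Nonempty → S ⊆ C

theorem absorbs_connectedComponentIn (B : Set (ℝ × ℝ)) (x : ℝ × ℝ) :
    Absorbs B (connectedComponentIn Bᶜ x) := by
  rintro S hS hSB ⟨y, hyS, hyC⟩
  rw [connectedComponentIn_eq hyC]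
  exact hS.subset_connectedComponentIn hyS hSB

/-- Points near `v` displaced to the side `s` of the direction `d` lie in `C`. -/
def OnSide (s : ℝ) (v d : ℝ × ℝ) (C : Set (ℝ × ℝ)) : Prop :=
  ∀ᶠ h in 𝓝[>] (0 : ℝ), v + (h * s) • perp d ∈ C

/-- The part of a sector within distance `r` of the apex `v` lies in `C`. -/
def SectorIn (s r : ℝ) (v d e : ℝ × ℝ) (C : Set (ℝ × ℝ)) : Prop :=
  ∀ y ∈ Metric.ball (0 : ℝ × ℝ) r, InSector s d e y → v + y ∈ C

theorem norm_sq_pos {d : ℝ × ℝ} (h : d ≠ 0) : 0 < d.1 ^ 2 + d.2 ^ 2 := by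
  by_contra h0
  have h1 : d.1 = 0 := by nlinarith [sq_nonneg d.1, sq_nonneg d.2]
  have h2 : d.2 = 0 := by nlinarith [sq_nonneg d.1, sq_nonneg d.2]
  exact h (Prod.ext h1 h2)

theorem eventually_smul_add_mem_ball (w u : ℝ × ℝ) {r : ℝ} (hw : ‖w‖ < r) :
    ∀ᶠ h in 𝓝[>] (0 : ℝ), w + h • u ∈ Metric.ball (0 : ℝ × ℝ) r := by
  have : Tendsto (fun c : ℝ => w + c • u) (𝓝 0) (𝓝 (w + (0 : ℝ) • u)) :=
    Continuous.tendsto (by fun_prop) 0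
  rw [zero_smul, add_zero] at this
  exact (this.mono_left nhdsWithin_le_nhds).eventually
    (Metric.isOpen_ball.mem_nhds (by simpa using hw))

theorem eventually_pos_add_mul {a : ℝ} (ha : 0 < a) (b : ℝ) :
    ∀ᶠ h in 𝓝[>] (0 : ℝ), 0 < a + h * b := by
  have : Tendsto (fun c : ℝ => a + c * b) (𝓝 0) (𝓝 (a + 0 * b)) :=
    Continuous.tendsto (by fun_prop) 0
  rw [zero_mul, add_zero] at this
  exact (this.mono_left nhdsWithin_le_nhds).eventually (lt_mem_nhds ha)

theorem eventually_inSector_out {s : ℝ} (hs : s ^ 2 = 1) {d e : ℝ × ℝ} (he : e ≠ 0) {τ : ℝ}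
    (hτ : 0 < τ) : ∀ᶠ h in 𝓝[>] (0 : ℝ), InSector s d e (τ • e + (h * s) • perp e) := by
  have k1 : ∀ h, s * cross e (τ • e + (h * s) • perp e) = h * (e.1 ^ 2 + e.2 ^ 2) := fun h => by
    simp only [cross, perp, Prod.smul_fst, Prod.smul_snd, smul_eq_mul, Prod.fst_add, Prod.snd_add]
    linear_combination h * (e.1 ^ 2 + e.2 ^ 2) * hs
  have k2 : ∀ h, s * cross d (τ • e + (h * s) • perp e) =
      τ * (s * cross d e) + h * (d.1 * e.1 + d.2 * e.2) := fun h => by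
    simp only [cross, perp, Prod.smul_fst, Prod.smul_snd, smul_eq_mul, Prod.fst_add, Prod.snd_add]
    linear_combination h * (d.1 * e.1 + d.2 * e.2) * hs
  have he0 := norm_sq_pos he
  by_cases hc : 0 < s * cross d e
  · filter_upwards [eventually_pos_add_mul (mul_pos hτ hc) (d.1 * e.1 + d.2 * e.2),
      self_mem_nhdsWithin] with h h1 (h2 : 0 < h)
    exact Or.inl ⟨hc, by rw [k2]; exact h1, by rw [k1]; positivity⟩
  · filter_upwards [self_mem_nhdsWithin] with h (h2 : 0 < h)
    exact Or.inr ⟨not_lt.1 hc, Or.inr (by rw [k1]; positivity)⟩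

theorem eventually_inSector_in {s : ℝ} (hs : s ^ 2 = 1) {d e : ℝ × ℝ} (hd : d ≠ 0) {τ : ℝ}
    (hτ : 0 < τ) : ∀ᶠ h in 𝓝[>] (0 : ℝ), InSector s d e (-(τ • d) + (h * s) • perp d) := by
  have k1 : ∀ h, s * cross d (-(τ • d) + (h * s) • perp d) = h * (d.1 ^ 2 + d.2 ^ 2) := fun h => by
    simp only [cross, perp, Prod.smul_fst, Prod.smul_snd, smul_eq_mul, Prod.fst_add, Prod.snd_add,
      Prod.fst_neg, Prod.snd_neg]
    linear_combination h * (d.1 ^ 2 + d.2 ^ 2) * hs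
  have k2 : ∀ h, s * cross e (-(τ • d) + (h * s) • perp d) =
      τ * (s * cross d e) + h * (d.1 * e.1 + d.2 * e.2) := fun h => by
    simp only [cross, perp, Prod.smul_fst, Prod.smul_snd, smul_eq_mul, Prod.fst_add, Prod.snd_add,
      Prod.fst_neg, Prod.snd_neg]
    linear_combination h * (d.1 * e.1 + d.2 * e.2) * hs
  have he0 := norm_sq_pos hd
  by_cases hc : 0 < s * cross d e
  · filter_upwards [eventually_pos_add_mul (mul_pos hτ hc) (d.1 * e.1 + d.2 * e.2),
      self_mem_nhdsWithin] with h h1 (h2 : 0 < h)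
    exact Or.inl ⟨hc, by rw [k1]; positivity, by rw [k2]; exact h1⟩
  · filter_upwards [self_mem_nhdsWithin] with h (h2 : 0 < h)
    exact Or.inr ⟨not_lt.1 hc, Or.inl (by rw [k1]; positivity)⟩

theorem inSector_straight {s : ℝ} (hs : s ^ 2 = 1) {d : ℝ × ℝ} (hd : d ≠ 0) {h : ℝ} (hh : 0 < h) :
    InSector s d d (0 + (h * s) • perp d) := by
  have k1 : s * cross d (0 + (h * s) • perp d) = h * (d.1 ^ 2 + d.2 ^ 2) := by
    simp only [cross, perp, Prod.smul_fst, Prod.smul_snd, smul_eq_mul, Prod.fst_add, Prod.snd_add,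
      Prod.fst_zero, Prod.snd_zero]
    linear_combination h * (d.1 ^ 2 + d.2 ^ 2) * hs
  have := norm_sq_pos hd
  exact Or.inr ⟨by simp [cross, mul_comm], Or.inl (by rw [k1]; positivity)⟩

/-- At a boundary point, each of the two sectors is contained in a component as soon as it meets
it, and the points just beside the adjacent sides belong to the sectors. -/
theorem LocalRays.exists_sectorIn {B : Set (ℝ × ℝ)} {v d e : ℝ × ℝ} (hL : LocalRays B v d e)
    (hde : Unfolded d e) {s : ℝ} (hs : s ^ 2 = 1) :
    ∃ r > (0 : ℝ), ∃ ε > (0 : ℝ), ∀ C, Absorbs B C →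
      (∀ y ∈ Metric.ball (0 : ℝ × ℝ) r, InSector s d e y → v + y ∈ C → SectorIn s r v d e C) ∧
      (∀ τ : ℝ, 0 < τ → τ < ε → (SectorIn s r v d e C ↔ OnSide s (v + τ • e) e C)) ∧
      (∀ τ : ℝ, 0 < τ → τ < ε → (SectorIn s r v d e C ↔ OnSide s (v + -(τ • d)) d C)) ∧
      (e = d → (SectorIn s r v d e C ↔ OnSide s v d C)) := by
  obtain ⟨r, hr, hrB⟩ := Metric.eventually_nhds_iff_ball.1 hL
  have hd0 : 0 < ‖d‖ := norm_pos_iff.2 hde.1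
  have he0 : 0 < ‖e‖ := norm_pos_iff.2 hde.2.1
  -- The bound keeps `τ • d` and `τ • e` inside the ball of radius `r`. Both radii are chosen before
  -- `C`.
  refine ⟨r, hr, min (r / ‖d‖) (r / ‖e‖), by positivity, fun C hC => ?_⟩
  have h1 : ∀ y ∈ Metric.ball (0 : ℝ × ℝ) r, InSector s d e y → v + y ∈ C →
      SectorIn s r v d e C := by
    intro y hy hys hyC z hz hzs
    have hpre : IsPreconnected ((v + ·) '' {y | y ∈ Metric.ball (0 : ℝ × ℝ) r ∧ InSector s d e y}) :=
      (isPreconnected_ball_inter_sector hs hde hr).image _ (by fun_prop)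
    refine hC _ hpre ?_ ⟨v + y, ⟨y, ⟨hy, hys⟩, rfl⟩, hyC⟩ ⟨z, ⟨hz, hzs⟩, rfl⟩
    rintro _ ⟨w, ⟨hw, hws⟩, rfl⟩ hwB
    exact hws.not_ray ((hrB w hw).1 hwB)
  have h2 : ∀ w u : ℝ × ℝ, ‖w‖ < r → (∀ᶠ h in 𝓝[>] (0 : ℝ), InSector s d e (w + (h * s) • perp u)) →
      (SectorIn s r v d e C ↔ OnSide s (v + w) u C) := by
    intro w u hw hev
    have hb := eventually_smul_add_mem_ball w (s • perp u) hw
    constructor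
    · intro hS
      filter_upwards [hev, hb] with h hh1 hh2
      rw [smul_smul] at hh2
      rw [add_assoc]
      exact hS _ hh2 hh1
    · intro hO
      obtain ⟨h, ⟨hh1, hh2⟩, hh3⟩ := ((hev.and hb).and hO).exists
      rw [smul_smul] at hh2
      rw [add_assoc] at hh3
      exact h1 _ hh2 hh1 hh3
  refine ⟨h1, fun τ hτ hτe => h2 _ _ ?_ (eventually_inSector_out hs hde.2.1 hτ),
    fun τ hτ hτe => h2 _ _ ?_ (eventually_inSector_in hs hde.1 hτ), ?_⟩
  · rw [norm_smul, Real.norm_of_nonneg hτ.le]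
    exact (lt_div_iff₀ he0).1 (hτe.trans_le (min_le_right _ _))
  · rw [norm_neg, norm_smul, Real.norm_of_nonneg hτ.le]
    exact (lt_div_iff₀ hd0).1 (hτe.trans_le (min_le_left _ _))
  · rintro rfl
    have := h2 0 e (by simpa using hr) (by
      filter_upwards [self_mem_nhdsWithin] with h hh
      exact inSector_straight hs hde.1 hh)
    rwa [add_zero] at this

end LatticePolygon

/-! ### Following a component along the sides of a simple chain -/

namespace LatticePolygon
open Filter Topology Set
variable {n : ℕ} {f : ℕ → ℝ × ℝ}

theorem eventually_norm_lt_of_pos {c : ℝ} (hc : 0 < c) : ∀ᶠ y in 𝓝 (0 : ℝ × ℝ), ‖y‖ < c := by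
  filter_upwards [Metric.ball_mem_nhds (0 : ℝ × ℝ) hc] with y hy
  simpa using hy

theorem eventually_mem_segment_left {p q : ℝ × ℝ} (h : p ≠ q) :
    ∀ᶠ y in 𝓝 (0 : ℝ × ℝ), p + y ∈ segment ℝ p q ↔ ∃ b : ℝ, 0 ≤ b ∧ y = b • (q - p) := by
  have hd : 0 < ‖q - p‖ := norm_pos_iff.2 (sub_ne_zero.2 h.symm)
  filter_upwards [eventually_norm_lt_of_pos hd] with y hy
  rw [mem_segment_iff_exists]
  constructor
  · rintro ⟨t, ht, he⟩
    exact ⟨t, ht.1, add_left_cancel he⟩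
  · rintro ⟨b, hb, rfl⟩
    rw [norm_smul, Real.norm_of_nonneg hb] at hy
    exact ⟨b, ⟨hb, by nlinarith⟩, rfl⟩

theorem eventually_mem_segment_right {p q : ℝ × ℝ} (h : p ≠ q) :
    ∀ᶠ y in 𝓝 (0 : ℝ × ℝ), q + y ∈ segment ℝ p q ↔ ∃ a : ℝ, 0 ≤ a ∧ y = -(a • (q - p)) := by
  filter_upwards [eventually_mem_segment_left h.symm] with y hy
  rw [segment_symm, hy]
  simp only [← smul_neg, neg_sub]

theorem eventually_mem_segment_mid {p q : ℝ × ℝ} (h : p ≠ q) {t : ℝ} (ht : t ∈ Ioo (0 : ℝ) 1) :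
    ∀ᶠ y in 𝓝 (0 : ℝ × ℝ), p + t • (q - p) + y ∈ segment ℝ p q ↔
      (∃ a : ℝ, 0 ≤ a ∧ y = -(a • (q - p))) ∨ ∃ b : ℝ, 0 ≤ b ∧ y = b • (q - p) := by
  have hd : 0 < ‖q - p‖ := norm_pos_iff.2 (sub_ne_zero.2 h.symm)
  filter_upwards [eventually_norm_lt_of_pos (mul_pos ht.1 hd),
    eventually_norm_lt_of_pos (mul_pos (sub_pos.2 ht.2) hd)] with y hy1 hy2
  rw [mem_segment_iff_exists]
  constructor
  · rintro ⟨u, hu, he⟩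
    have : y = (u - t) • (q - p) := by
      rw [add_assoc] at he
      rw [sub_smul, ← add_left_cancel he]; abel
    rcases le_total t u with h' | h'
    · exact Or.inr ⟨u - t, by linarith, this⟩
    · exact Or.inl ⟨t - u, by linarith, by rw [this, ← neg_smul, neg_sub]⟩
  · rintro (⟨b, hb, rfl⟩ | ⟨b, hb, rfl⟩)
    · rw [norm_neg, norm_smul, Real.norm_of_nonneg hb] at hy1
      have : b < t := lt_of_mul_lt_mul_right hy1 hd.le
      exact ⟨t - b, ⟨by linarith, by linarith [ht.2]⟩, by rw [sub_smul]; abel⟩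
    · rw [norm_smul, Real.norm_of_nonneg hb] at hy2
      have : b < 1 - t := lt_of_mul_lt_mul_right hy2 hd.le
      exact ⟨t + b, ⟨by linarith [ht.1], by linarith⟩, by rw [add_smul]; abel⟩

namespace SimpleChain

theorem pos (hf : SimpleChain n f) : 0 < n := by have := hf.three_le; omega

/-- The sides not indexed by `J` are, over one period, finitely many closed sets that miss `v`, so
they stay away from a neighbourhood of `v`. -/
theorem eventually_add_mem_trace_iff (hf : SimpleChain n f) {v : ℝ × ℝ} (m : ℕ) {P : ℝ × ℝ → Prop}
    {J : Finset ℕ} (hJ : ∀ᶠ y in 𝓝 (0 : ℝ × ℝ),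
      (∃ i ∈ J, v + y ∈ segment ℝ (f i) (f (i + 1))) ↔ P y)
    (hv : ∀ i, m ≤ i → i < m + n → i ∉ J → v ∉ segment ℝ (f i) (f (i + 1))) :
    ∀ᶠ y in 𝓝 (0 : ℝ × ℝ), v + y ∈ trace f ↔ P y := by
  have hs : ∀ᶠ y in 𝓝 (0 : ℝ × ℝ), ∀ i ∈ Finset.Ico m (m + n), i ∉ J →
      v + y ∉ segment ℝ (f i) (f (i + 1)) := by
    refine (Filter.eventually_all_finset _).2 fun i hi => ?_
    rw [Finset.mem_Ico] at hi
    by_cases hiJ : i ∈ J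
    · simp [hiJ]
    have hc : Tendsto (fun y => v + y) (𝓝 (0 : ℝ × ℝ)) (𝓝 v) := by
      have : Tendsto (fun y => v + y) (𝓝 (0 : ℝ × ℝ)) (𝓝 (v + 0)) :=
        Continuous.tendsto (by fun_prop) 0
      rwa [add_zero] at this
    filter_upwards [hc.eventually
      ((isClosed_segment (f i) (f (i + 1))).isOpen_compl.mem_nhds (hv i hi.1 hi.2 hiJ))] with y hy _
    exact hy
  filter_upwards [hs, hJ] with y hy hyJ
  rw [← hyJ]
  constructor
  · intro h
    obtain ⟨i, hi1, hi2, hi3⟩ := exists_lt_of_mem_trace hf.periodic hf.pos m h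
    by_contra hcon
    exact hy i (Finset.mem_Ico.2 ⟨hi1, hi2⟩) (fun hiJ => hcon ⟨i, hiJ, hi3⟩) hi3
  · rintro ⟨i, -, h⟩
    exact segment_subset_trace f i h

theorem unfolded (hf : SimpleChain n f) (i : ℕ) :
    Unfolded (f (i + 1) - f i) (f (i + 2) - f (i + 1)) := by
  have hd : f (i + 1) - f i ≠ 0 := sub_ne_zero.2 (hf.ne i).symm
  have he : f (i + 2) - f (i + 1) ≠ 0 := sub_ne_zero.2 (hf.ne (i + 1)).symm
  refine ⟨hd, he, fun h => ?_⟩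
  obtain ⟨c, hc⟩ := exists_smul_eq_of_cross_eq_zero hd h
  refine ⟨c, ?_, hc⟩
  by_contra hc0
  have hc1 : c ≠ 0 := by rintro rfl; exact he (by simpa using hc)
  have hc2 : c < 0 := lt_of_le_of_ne (not_lt.1 hc0) hc1
  have h3 := hf.three_le
  -- If the next side folded back, the point at parameter `b` before the vertex would lie on both
  -- sides: `b ≤ 1` keeps it on the first, `b ≤ -c` on the second.
  have key : ∀ b : ℝ, 0 < b → b ≤ 1 → b ≤ -c →
      f (i + 1) + -(b • (f (i + 1) - f i)) = f (i + 1) := by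
    intro b hb0 hb1 hbc
    have := hf.inter i (i + 1) (f (i + 1) + -(b • (f (i + 1) - f i))) (by omega) (by omega)
      (mem_segment_iff_exists.2 ⟨1 - b, ⟨by linarith, by linarith⟩, by rw [sub_smul, one_smul]; abel⟩)
      (mem_segment_iff_exists.2 ⟨-b / c, ⟨?_, ?_⟩, ?_⟩)
    · rcases this with ⟨-, h⟩ | ⟨h, -⟩
      · exact h
      · omega
    · exact div_nonneg_of_nonpos (by linarith) hc2.le
    · exact (div_le_one_of_neg hc2).2 (by linarith)
    · rw [show i + 1 + 1 = i + 2 from rfl, hc, smul_smul, div_mul_cancel₀ _ hc1, neg_smul]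
  have := key (min 1 (-c)) (lt_min one_pos (by linarith)) (min_le_left _ _) (min_le_right _ _)
  rw [add_eq_left, neg_eq_zero, smul_eq_zero] at this
  rcases this with h | h
  · have := lt_min one_pos (show 0 < -c by linarith)
    linarith
  · exact hd h

theorem localRays_vertex (hf : SimpleChain n f) (i : ℕ) :
    LocalRays (trace f) (f (i + 1)) (f (i + 1) - f i) (f (i + 2) - f (i + 1)) := by
  refine hf.eventually_add_mem_trace_iff i (J := {i, i + 1}) ?_ ?_
  · filter_upwards [eventually_mem_segment_right (hf.ne i),
      eventually_mem_segment_left (hf.ne (i + 1))] with y h1 h2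
    simp [h1, h2]
  · intro j hj1 hj2 hjJ hm
    simp only [Finset.mem_insert, Finset.mem_singleton, not_or] at hjJ
    have h1 := hf.inter i j _ (by omega) hj2 (right_mem_segment _ _ _) hm
    rcases h1 with ⟨h, -⟩ | ⟨-, h⟩
    · exact hjJ.2 h
    · exact hf.ne i h.symm

theorem localRays_mid (hf : SimpleChain n f) (i : ℕ) {t : ℝ} (ht : t ∈ Ioo (0 : ℝ) 1) :
    LocalRays (trace f) (f i + t • (f (i + 1) - f i)) (f (i + 1) - f i) (f (i + 1) - f i) := by
  have hd : f (i + 1) - f i ≠ 0 := sub_ne_zero.2 (hf.ne i).symm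
  refine hf.eventually_add_mem_trace_iff i (J := {i}) ?_ ?_
  · filter_upwards [eventually_mem_segment_mid (hf.ne i) ht] with y h1
    simp [h1]
  · intro j hj1 hj2 hjJ hm
    simp only [Finset.mem_singleton] at hjJ
    have h1 := hf.inter i j _ (by omega) hj2
      (mem_segment_iff_exists.2 ⟨t, ⟨ht.1.le, ht.2.le⟩, rfl⟩) hm
    rcases h1 with ⟨h, h'⟩ | ⟨-, h⟩
    · rw [h] at h'
      have : (t - 1) • (f (i + 1) - f i) = 0 := by
        rw [sub_smul, one_smul, eq_sub_of_add_eq' h']; abel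
      rcases smul_eq_zero.1 this with h | h
      · linarith [ht.2]
      · exact hd h
    · rcases smul_eq_zero.1 (add_eq_left.1 h) with h | h
      · exact ht.1.ne' h
      · exact hd h

/-- The set `C` contains all points just beside the `i`-th side, to its left (`s = 1`) or right
(`s = -1`). -/
def _root_.LatticePolygon.Side (f : ℕ → ℝ × ℝ) (s : ℝ) (C : Set (ℝ × ℝ)) (i : ℕ) : Prop :=
  ∀ t ∈ Ioo (0 : ℝ) 1, OnSide s (f i + t • (f (i + 1) - f i)) (f (i + 1) - f i) C

/-- Lying beside the side at parameter `t` is a locally constant condition in `t`, because nearby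
parameters share a sector; the open parameter interval is connected. -/
theorem side_of_onSide (hf : SimpleChain n f) {s : ℝ} (hs : s ^ 2 = 1) {C : Set (ℝ × ℝ)}
    (hC : Absorbs (trace f) C) {i : ℕ} {t : ℝ} (ht : t ∈ Ioo (0 : ℝ) 1)
    (h : OnSide s (f i + t • (f (i + 1) - f i)) (f (i + 1) - f i) C) : Side f s C i := by
  set d := f (i + 1) - f i with hd
  have hd0 : d ≠ 0 := sub_ne_zero.2 (hf.ne i).symm
  intro t' ht'
  refine (isPreconnected_Ioo (a := (0 : ℝ)) (b := 1)).induction₂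
    (fun t t' => OnSide s (f i + t • d) d C ↔ OnSide s (f i + t' • d) d C) ?_
    (fun x y z _ _ _ h1 h2 => h1.trans h2) (fun x y _ _ h => h.symm) ht ht' |>.1 h
  intro u hu
  obtain ⟨r, hr, ε, hε, H⟩ := (hf.localRays_mid i hu).exists_sectorIn
    ⟨hd0, hd0, fun _ => ⟨1, one_pos, (one_smul _ _).symm⟩⟩ hs
  obtain ⟨-, h2, h3, h4⟩ := H C hC
  filter_upwards [nhdsWithin_le_nhds (Metric.ball_mem_nhds u hε)] with w hw
  rw [Metric.mem_ball, Real.dist_eq, abs_lt] at hw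
  rw [← h4 rfl]
  rcases lt_trichotomy u w with h | h | h
  · rw [h2 (w - u) (by linarith) (by linarith), ← hd, add_assoc, ← add_smul]
    simp
  · rw [← h]; exact h4 rfl
  · rw [h3 (u - w) (by linarith) (by linarith), ← hd, ← neg_smul, add_assoc, ← add_smul]
    simp

theorem side_iff_sectorIn_in (hf : SimpleChain n f) {s : ℝ} (hs : s ^ 2 = 1) {C : Set (ℝ × ℝ)}
    (hC : Absorbs (trace f) C) (i : ℕ) {S : Prop} {v : ℝ × ℝ} {ε : ℝ} (hε : 0 < ε)
    (hv : v = f (i + 1)) (h : ∀ τ : ℝ, 0 < τ → τ < ε →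
      (S ↔ OnSide s (v + -(τ • (f (i + 1) - f i))) (f (i + 1) - f i) C)) : S ↔ Side f s C i := by
  obtain ⟨τ, h0, h1⟩ := exists_between (lt_min hε one_pos)
  have e : v + -(τ • (f (i + 1) - f i)) = f i + (1 - τ) • (f (i + 1) - f i) := by
    rw [hv, sub_smul, one_smul]; abel
  have hτ1 := h1.trans_le (min_le_right _ _)
  rw [h τ h0 (h1.trans_le (min_le_left _ _)), e]
  exact ⟨fun h => hf.side_of_onSide hs hC ⟨by linarith, by linarith⟩ h,
    fun h => h _ ⟨by linarith, by linarith⟩⟩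

theorem side_iff_sectorIn_out (hf : SimpleChain n f) {s : ℝ} (hs : s ^ 2 = 1) {C : Set (ℝ × ℝ)}
    (hC : Absorbs (trace f) C) (i : ℕ) {S : Prop} {v : ℝ × ℝ} {ε t : ℝ} (hε : 0 < ε)
    (ht : t ∈ Ico (0 : ℝ) 1)
    (hv : v = f i + t • (f (i + 1) - f i)) (h : ∀ τ : ℝ, 0 < τ → τ < ε →
      (S ↔ OnSide s (v + τ • (f (i + 1) - f i)) (f (i + 1) - f i) C)) : S ↔ Side f s C i := by
  obtain ⟨τ, h0, h1⟩ := exists_between (lt_min hε (sub_pos.2 ht.2))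
  have e : v + τ • (f (i + 1) - f i) = f i + (t + τ) • (f (i + 1) - f i) := by
    rw [hv, add_smul]; abel
  have hτ1 := h1.trans_le (min_le_right _ _)
  have := ht.1
  rw [h τ h0 (h1.trans_le (min_le_left _ _)), e]
  exact ⟨fun h => hf.side_of_onSide hs hC ⟨by linarith, by linarith⟩ h,
    fun h => h _ ⟨by linarith, by linarith⟩⟩

/-- The sector at the common vertex contains points beside the end of one side and beside the start
of the next, both on the side `s`. -/
theorem side_succ_iff (hf : SimpleChain n f) {s : ℝ} (hs : s ^ 2 = 1) {C : Set (ℝ × ℝ)}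
    (hC : Absorbs (trace f) C) (i : ℕ) : Side f s C i ↔ Side f s C (i + 1) := by
  obtain ⟨r, hr, ε, hε, H⟩ := (hf.localRays_vertex i).exists_sectorIn (hf.unfolded i) hs
  obtain ⟨-, h2, h3, -⟩ := H C hC
  rw [← hf.side_iff_sectorIn_in hs hC i hε rfl h3,
    ← hf.side_iff_sectorIn_out hs hC (i + 1) (t := 0) hε (by simp) (by simp) h2]

theorem side_iff (hf : SimpleChain n f) {s : ℝ} (hs : s ^ 2 = 1) {C : Set (ℝ × ℝ)}
    (hC : Absorbs (trace f) C) (i j : ℕ) : Side f s C i ↔ Side f s C j := by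
  have : ∀ i, Side f s C i ↔ Side f s C 0 := by
    intro i
    induction i with
    | zero => rfl
    | succ k ih => rw [← hf.side_succ_iff hs hC, ih]
  rw [this i, this j]

theorem exists_localRays (hf : SimpleChain n f) {b : ℝ × ℝ} (hb : b ∈ trace f) :
    ∃ d i, ∃ t ∈ Ico (0 : ℝ) 1, b = f i + t • (f (i + 1) - f i) ∧
      Unfolded d (f (i + 1) - f i) ∧ LocalRays (trace f) b d (f (i + 1) - f i) := by
  obtain ⟨i, hi⟩ := mem_iUnion.1 hb
  obtain ⟨t, ht, rfl⟩ := mem_segment_iff_exists.1 hi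
  have hd0 : f (i + 1) - f i ≠ 0 := sub_ne_zero.2 (hf.ne i).symm
  rcases ht.2.lt_or_eq with h1 | rfl
  · rcases ht.1.lt_or_eq with h0 | rfl
    · exact ⟨f (i + 1) - f i, i, t, ⟨h0.le, h1⟩, rfl,
        ⟨hd0, hd0, fun _ => ⟨1, one_pos, (one_smul _ _).symm⟩⟩, hf.localRays_mid i ⟨h0, h1⟩⟩
    -- At the start of side `i` the incoming side is the previous one, written cyclically as `i + m`
    -- with `n = m + 1`.
    · have hn := hf.pos
      obtain ⟨m, rfl⟩ : ∃ m, n = m + 1 := ⟨n - 1, by omega⟩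
      refine ⟨_, i + m + 1, 0, by simp, ?_, hf.unfolded (i + m), ?_⟩
      · simp [add_assoc, hf.periodic]
      · have := hf.localRays_vertex (i + m)
        convert this using 1
        rw [zero_smul, add_zero, add_assoc, hf.periodic]
  · refine ⟨_, i + 1, 0, by simp, by simp, hf.unfolded i, ?_⟩
    have := hf.localRays_vertex i
    convert this using 1
    simp

/-- A component whose sector at `b` is met contains the points beside all sides. -/
theorem exists_side (hf : SimpleChain n f) {b : ℝ × ℝ} (hb : b ∈ trace f) :
    ∃ r > (0 : ℝ), ∀ C, Absorbs (trace f) C → ∀ y ∈ Metric.ball (0 : ℝ × ℝ) r,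
      b + y ∉ trace f → b + y ∈ C → ∃ s : ℝ, s ^ 2 = 1 ∧ Side f s C 0 := by
  obtain ⟨d, i, t, ht, hbt, hu, hL⟩ := hf.exists_localRays hb
  obtain ⟨r0, hr0, hrB⟩ := Metric.eventually_nhds_iff_ball.1 hL
  obtain ⟨r1, hr1, ε1, hε1, H1⟩ := hL.exists_sectorIn hu (s := 1) (by norm_num)
  obtain ⟨r2, hr2, ε2, hε2, H2⟩ := hL.exists_sectorIn hu (s := -1) (by norm_num)
  refine ⟨min r0 (min r1 r2), by positivity, fun C hC y hy hyB hyC => ?_⟩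
  simp only [Metric.mem_ball, lt_min_iff] at hy
  rcases inSector_of_not_ray hu fun h => hyB ((hrB y hy.1).2 h) with h | h
  · refine ⟨1, by norm_num, ?_⟩
    obtain ⟨h1, h2, -⟩ := H1 C hC
    rw [hf.side_iff (by norm_num) hC 0 i,
      ← hf.side_iff_sectorIn_out (by norm_num) hC i hε1 ht hbt h2]
    exact h1 y hy.2.1 h hyC
  · refine ⟨-1, by norm_num, ?_⟩
    obtain ⟨h1, h2, -⟩ := H2 C hC
    rw [hf.side_iff (by norm_num) hC 0 i,
      ← hf.side_iff_sectorIn_out (by norm_num) hC i hε2 ht hbt h2]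
    exact h1 y hy.2.2 h hyC

/-- Every point off the chain can be joined to points beside the sides. -/
theorem exists_side_component (hf : SimpleChain n f) {x : ℝ × ℝ} (hx : x ∉ trace f) :
    ∃ s : ℝ, s ^ 2 = 1 ∧ Side f s (connectedComponentIn (trace f)ᶜ x) 0 := by
  set γ : ℝ → ℝ × ℝ := fun u => x + u • (f 0 - x) with hγ
  have hγc : Continuous γ := by fun_prop
  have hcl := (isCompact_trace hf.periodic hf.pos).isClosed
  -- The first point at which the segment from `x` to a vertex hits the chain; everything before it
  -- stays in the component of `x`.
  obtain ⟨u, ⟨hu1, hu2⟩, hmin⟩ := (isCompact_Icc.inter_right (hcl.preimage hγc)).exists_isLeast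
    (s := Icc (0 : ℝ) 1 ∩ γ ⁻¹' trace f)
    ⟨1, by simp, by simpa [hγ] using vertex_mem_trace f 0⟩
  have hu0 : 0 < u := by
    refine lt_of_le_of_ne hu1.1 ?_
    rintro rfl
    exact hx (by simpa [hγ] using hu2)
  have hoff : ∀ w, 0 ≤ w → w < u → γ w ∉ trace f := fun w h0 h1 hm =>
    absurd (hmin ⟨⟨h0, h1.le.trans hu1.2⟩, hm⟩) (not_le.2 h1)
  have hsub : γ '' Ico 0 u ⊆ connectedComponentIn (trace f)ᶜ x := by
    refine (isPreconnected_Ico.image _ hγc.continuousOn).subset_connectedComponentIn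
      ⟨0, ⟨le_rfl, hu0⟩, by simp [hγ]⟩ ?_
    rintro _ ⟨w, hw, rfl⟩
    exact hoff w hw.1 hw.2
  obtain ⟨r, hr, H⟩ := hf.exists_side hu2
  have hball : ∀ᶠ w in 𝓝[<] u, γ w - γ u ∈ Metric.ball (0 : ℝ × ℝ) r := by
    have : Tendsto (fun w => γ w - γ u) (𝓝 u) (𝓝 (γ u - γ u)) := Continuous.tendsto (by fun_prop) u
    rw [sub_self] at this
    exact (this.mono_left nhdsWithin_le_nhds).eventually (Metric.ball_mem_nhds _ hr)
  obtain ⟨w, hw1, hw2⟩ := (hball.and (Ioo_mem_nhdsLT hu0)).exists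
  refine H _ (absorbs_connectedComponentIn _ x) _ hw1 ?_ ?_
  · rw [add_sub_cancel]; exact hoff w hw2.1.le hw2.2
  · rw [add_sub_cancel]; exact hsub ⟨w, ⟨hw2.1.le, hw2.2⟩, rfl⟩

theorem trace_subset_closure (hf : SimpleChain n f) {s : ℝ} (hs : s ^ 2 = 1) {C : Set (ℝ × ℝ)}
    (hC : Absorbs (trace f) C) (h : Side f s C 0) : trace f ⊆ closure C := by
  have h1 : ∀ i, ∀ t ∈ Ioo (0 : ℝ) 1, f i + t • (f (i + 1) - f i) ∈ closure C := by
    intro i t ht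
    have hO := (hf.side_iff hs hC 0 i).1 h t ht
    have hT : Tendsto (fun h : ℝ => f i + t • (f (i + 1) - f i) + (h * s) • perp (f (i + 1) - f i))
        (𝓝[>] 0) (𝓝 (f i + t • (f (i + 1) - f i))) := by
      have : Tendsto (fun h : ℝ => f i + t • (f (i + 1) - f i) + (h * s) • perp (f (i + 1) - f i))
        (𝓝 0) (𝓝 (f i + t • (f (i + 1) - f i) + ((0 : ℝ) * s) • perp (f (i + 1) - f i))) :=
          Continuous.tendsto (by fun_prop) 0
      rw [zero_mul, zero_smul, add_zero] at this
      exact this.mono_left nhdsWithin_le_nhds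
    exact mem_closure_of_tendsto hT hO
  intro b hb
  obtain ⟨i, hi⟩ := mem_iUnion.1 hb
  obtain ⟨t, ht, rfl⟩ := mem_segment_iff_exists.1 hi
  have hc : Continuous fun t : ℝ => f i + t • (f (i + 1) - f i) := by fun_prop
  have : closure (Ioo (0 : ℝ) 1) ⊆ (fun t : ℝ => f i + t • (f (i + 1) - f i)) ⁻¹' closure C :=
    closure_minimal (h1 i) (isClosed_closure.preimage hc)
  rw [closure_Ioo zero_ne_one] at this
  exact this ht

end SimpleChain
end LatticePolygon

/-! ### The Jordan curve theorem for polygons -/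

namespace LatticePolygon
open Filter Topology Set
variable {n : ℕ} {f : ℕ → ℝ × ℝ}

theorem volume_line_eq_zero (p d : ℝ × ℝ) : volume (range fun t : ℝ => p + t • d) = 0 := by
  have h : (AffineSubspace.mk' p (Submodule.span ℝ {d}) : AffineSubspace ℝ (ℝ × ℝ)) ≠ ⊤ := by
    intro h
    have h' : ∀ v : ℝ × ℝ, ∃ c : ℝ, c • d = v := by
      intro v
      have : p + v ∈ (AffineSubspace.mk' p (Submodule.span ℝ {d}) : AffineSubspace ℝ (ℝ × ℝ)) := by
        rw [h]; trivial
      rw [AffineSubspace.mem_mk', vsub_eq_sub, add_sub_cancel_left] at this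
      exact Submodule.mem_span_singleton.1 this
    obtain ⟨a, ha⟩ := h' (1, 0)
    obtain ⟨b, hb⟩ := h' (0, 1)
    simp only [Prod.ext_iff, Prod.smul_fst, Prod.smul_snd, smul_eq_mul] at ha hb
    have : (a * d.1) * (b * d.2) = (a * d.2) * (b * d.1) := by ring
    rw [ha.1, hb.2, ha.2] at this
    norm_num at this
  refine measure_mono_null ?_ (Measure.addHaar_affineSubspace volume _ h)
  rintro _ ⟨t, rfl⟩
  rw [SetLike.mem_coe, AffineSubspace.mem_mk', vsub_eq_sub, add_sub_cancel_left]
  exact Submodule.mem_span_singleton.2 ⟨t, rfl⟩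

theorem volume_segment_eq_zero (p q : ℝ × ℝ) : volume (segment ℝ p q) = 0 := by
  refine measure_mono_null ?_ (volume_line_eq_zero p (q - p))
  intro x hx
  obtain ⟨t, -, rfl⟩ := mem_segment_iff_exists.1 hx
  exact ⟨t, rfl⟩

/-- The points off `B` whose component in the complement of `B` is bounded. -/
def enclosed (B : Set (ℝ × ℝ)) : Set (ℝ × ℝ) :=
  {x | x ∉ B ∧ Bornology.IsBounded (connectedComponentIn Bᶜ x)}

/-- The properties of a Jordan curve used in comparing the regions enclosed by several curves. -/
structure JordanSet (B : Set (ℝ × ℝ)) : Prop where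
  isCompact : IsCompact B
  null : volume B = 0
  isOpen_enclosed : IsOpen (enclosed B)
  isBounded_enclosed : Bornology.IsBounded (enclosed B)
  isClosed_union : IsClosed (B ∪ enclosed B)
  subset_closure : B ⊆ closure (enclosed B)

theorem continuousOn_of_eventually_eq {Y : Type*} [TopologicalSpace Y] {g : ℝ × ℝ → Y}
    {S : Set (ℝ × ℝ)} (h : ∀ x ∈ S, ∀ᶠ y in 𝓝 x, g y = g x) : ContinuousOn g S := fun x hx =>
  (continuousAt_const.congr ((h x hx).mono fun _ hy => hy.symm)).continuousWithinAt

namespace SimpleChain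

/-- At a lexicographically least vertex the chain must turn: were it straight there, the vertex
would lie strictly between its two neighbours, one of which would then be smaller. -/
theorem exists_cross_ne_zero (hf : SimpleChain n f) :
    ∃ i, cross (f (i + 1) - f i) (f (i + 2) - f (i + 1)) ≠ 0 := by
  obtain ⟨j, hj, hmin⟩ := (Finset.range n).exists_min_image (fun i => toLex (f i))
    ⟨0, Finset.mem_range.2 hf.pos⟩
  have hmin' : ∀ i, toLex (f j) ≤ toLex (f i) := fun i => by
    rw [← apply_mod_of_periodic hf.periodic i]
    exact hmin _ (Finset.mem_range.2 (Nat.mod_lt _ hf.pos))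
  have hn := hf.pos
  obtain ⟨m, rfl⟩ : ∃ m, n = m + 1 := ⟨n - 1, by omega⟩
  -- `j + m` is the cyclic predecessor of the least vertex `j`, as `n = m + 1`.
  refine ⟨j + m, fun h => ?_⟩
  obtain ⟨hd, -, hc⟩ := hf.unfolded (j + m)
  obtain ⟨c, hc0, hc⟩ := hc h
  have e : f (j + m + 1) = f j := by rw [add_assoc, hf.periodic]
  rw [e] at hc hd
  have h1 := hmin' (j + m)
  have h2 := hmin' (j + m + 2)
  rw [Prod.Lex.toLex_le_toLex] at h1 h2
  simp only [Prod.ext_iff, Prod.smul_fst, Prod.smul_snd, Prod.fst_sub, Prod.snd_sub,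
    smul_eq_mul] at hc
  refine hd ?_
  ext
  · simp only [Prod.fst_sub, Prod.fst_zero]
    rcases h1 with h1 | h1 <;> rcases h2 with h2 | h2 <;> nlinarith
  · simp only [Prod.snd_sub, Prod.snd_zero]
    rcases h1 with h1 | h1 <;> rcases h2 with h2 | h2 <;> nlinarith

theorem exists_nonvertical (hf : SimpleChain n f) :
    ∃ i ∈ Finset.range n, (f i).1 ≠ (f (i + 1)).1 := by
  by_contra! h
  have h' : ∀ i, (f i).1 = (f (i + 1)).1 := fun i => by
    have := h (i % n) (Finset.mem_range.2 (Nat.mod_lt _ hf.pos))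
    rwa [apply_mod_of_periodic hf.periodic, apply_mod_succ_of_periodic hf.periodic] at this
  obtain ⟨i, hi⟩ := hf.exists_cross_ne_zero
  refine hi ?_
  simp [cross, h' i, h' (i + 1)]

/-- The points are taken just below and just above the midpoint of a nonvertical side. That side
contributes a crossing only for the lower point. The other sides avoid the midpoint, and a vertical
displacement leaves `rightOf`, hence the corrections `upperJump`, unchanged. -/
theorem exists_wind_jump (hf : SimpleChain n f) :
    ∃ x y, x ∉ trace f ∧ y ∉ trace f ∧
      (wind n f x - wind n f y = 1 ∨ wind n f x - wind n f y = -1) := by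
  obtain ⟨i, hi, hv⟩ := hf.exists_nonvertical
  set d := f (i + 1) - f i with hd
  have hd1 : d.1 ≠ 0 := sub_ne_zero.2 hv.symm
  set m := f i + (1 / 2 : ℝ) • d with hm
  have hL := hf.localRays_mid i (t := 1 / 2) (by norm_num)
  rw [← hd, ← hm] at hL
  have h1 : ∀ᶠ y in 𝓝 m, ∀ j ∈ Finset.range n, j ≠ i →
      crossing (f j) (f (j + 1)) y - crossing (f j) (f (j + 1)) m =
      (upperJump m (f j) y - upperJump m (f j) m) -
        (upperJump m (f (j + 1)) y - upperJump m (f (j + 1)) m) := by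
    refine (Filter.eventually_all_finset _).2 fun j hj => ?_
    by_cases hji : j = i
    · simp [hji]
    have : m ∉ segment ℝ (f j) (f (j + 1)) := by
      intro hmj
      have hmi : m ∈ segment ℝ (f i) (f (i + 1)) :=
        mem_segment_iff_exists.2 ⟨1 / 2, by norm_num, rfl⟩
      have hne1 : m ≠ f i := fun h => by
        rw [hm, add_eq_left, smul_eq_zero] at h
        rcases h with h | h
        · norm_num at h
        · exact hd1 (by rw [h]; rfl)
      have hne2 : m ≠ f (i + 1) := fun h => by
        have : f (i + 1) = f i + d := by rw [hd]; abel
        rw [hm, this, add_right_inj] at h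
        have := congrArg Prod.fst h
        simp only [Prod.smul_fst, smul_eq_mul] at this
        exact hd1 (by linarith)
      have hj' := Finset.mem_range.1 hj
      have hi' := Finset.mem_range.1 hi
      rcases lt_or_gt_of_ne hji with hlt | hlt
      · rcases hf.inter j i m hlt (by omega) hmj hmi with ⟨-, h⟩ | ⟨h, h'⟩
        · exact hne1 h
        · exact hne2 (by rw [h, hf.periodic]; exact h')
      · rcases hf.inter i j m hlt (by omega) hmi hmj with ⟨h, h'⟩ | ⟨-, h⟩
        · exact hne2 (by rw [← h]; exact h')
        · exact hne1 h
    filter_upwards [eventually_crossing_eq this] with y hy _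
    exact hy
  have hT : ∀ c : ℝ, Tendsto (fun h : ℝ => m + ((0 : ℝ), c * h)) (𝓝[>] 0) (𝓝 m) := fun c => by
    have : Tendsto (fun h : ℝ => m + ((0 : ℝ), c * h)) (𝓝 0) (𝓝 (m + ((0 : ℝ), c * 0))) :=
      Continuous.tendsto (by fun_prop) 0
    rw [mul_zero, show ((0 : ℝ), (0 : ℝ)) = 0 from rfl, add_zero] at this
    exact this.mono_left nhdsWithin_le_nhds
  have hT' : ∀ c : ℝ, Tendsto (fun h : ℝ => ((0 : ℝ), c * h)) (𝓝[>] 0) (𝓝 0) := fun c => by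
    have : Tendsto (fun h : ℝ => ((0 : ℝ), c * h)) (𝓝 0) (𝓝 ((0 : ℝ), c * 0)) :=
      Continuous.tendsto (by fun_prop) 0
    rw [mul_zero] at this
    exact this.mono_left nhdsWithin_le_nhds
  obtain ⟨h, ⟨⟨⟨⟨hu, hl⟩, hLu⟩, hLl⟩, hpos⟩⟩ := (((((hT 1).eventually h1).and
    ((hT (-1)).eventually h1)).and ((hT' 1).eventually hL)).and
      ((hT' (-1)).eventually hL)).and self_mem_nhdsWithin |>.exists
  have hpos : 0 < h := hpos
  have hray : ∀ c : ℝ, c ≠ 0 → ¬ ((∃ a : ℝ, 0 ≤ a ∧ ((0 : ℝ), c * h) = -(a • d)) ∨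
      ∃ b : ℝ, 0 ≤ b ∧ ((0 : ℝ), c * h) = b • d) := by
    intro c hc
    have : ∀ a : ℝ, ((0 : ℝ), c * h) ≠ a • d := fun a ha => by
      simp only [Prod.ext_iff, Prod.smul_fst, Prod.smul_snd, smul_eq_mul] at ha
      rcases mul_eq_zero.1 ha.1.symm with h0 | h0
      · rw [h0, zero_mul, zero_mul] at ha
        exact (mul_ne_zero hc hpos.ne') ha.2
      · exact hd1 h0
    rintro (⟨a, -, ha⟩ | ⟨a, -, ha⟩)
    · exact this (-a) (by rw [ha, neg_smul])
    · exact this a ha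
  refine ⟨m + (0, -1 * h), m + (0, 1 * h), fun hm' => hray (-1) (by norm_num) (hLl.1 hm'),
    fun hm' => hray 1 (by norm_num) (hLu.1 hm'), ?_⟩
  have hro : ∀ v c, rightOf v (m + ((0 : ℝ), c * h)) = rightOf v m := fun v c => by simp [rightOf]
  have huj : ∀ v c, upperJump m v (m + ((0 : ℝ), c * h)) = upperJump m v m := fun v c => by
    simp only [upperJump, hro]
  have hfe : f (i + 1) = f i + d := by rw [hd]; abel
  have hd2 : 0 < d.1 ^ 2 := by positivity
  have hb : ∀ c, IsBelow (f i) (f (i + 1)) (m + ((0 : ℝ), c * h)) ↔ c < 0 := by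
    intro c
    unfold IsBelow
    have : ((f (i + 1)).1 - (m + ((0 : ℝ), c * h)).1) * (f i).2 +
        ((m + ((0 : ℝ), c * h)).1 - (f i).1) * (f (i + 1)).2 = m.2 * d.1 := by
      rw [hfe, hm]; simp; ring
    rw [this, hfe]
    simp only [Prod.fst_add, Prod.snd_add, add_sub_cancel_left]
    rw [show m.2 * d.1 * d.1 = m.2 * d.1 ^ 2 by ring, mul_lt_mul_iff_of_pos_right hd2]
    constructor <;> intro hh <;> nlinarith
  rw [wind, wind, ← Finset.sum_sub_distrib, Finset.sum_eq_single_of_mem i hi]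
  · rw [crossing, crossing, if_pos ((hb _).2 (by norm_num)),
      if_neg (mt (hb _).1 (by norm_num)), hro, hro]
    have hmf : m.1 = (f i).1 + 1 / 2 * d.1 := rfl
    have hfs : (f (i + 1)).1 = (f i).1 + d.1 := by rw [hfe]; rfl
    unfold rightOf
    rw [hmf, hfs]
    rcases lt_or_gt_of_ne hd1 with h0 | h0
    · rw [if_neg (by linarith), if_pos (by linarith)]; norm_num
    · rw [if_pos (by linarith), if_neg (by linarith)]; norm_num
  · intro j hj hji
    have e1 := hu j hj hji
    have e2 := hl j hj hji
    simp only [huj, sub_self] at e1 e2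
    linarith

theorem component_eq_of_side {s : ℝ} {x y : ℝ × ℝ}
    (hx : Side f s (connectedComponentIn (trace f)ᶜ x) 0)
    (hy : Side f s (connectedComponentIn (trace f)ᶜ y) 0) :
    connectedComponentIn (trace f)ᶜ x = connectedComponentIn (trace f)ᶜ y := by
  obtain ⟨h, h1, h2⟩ := ((hx (1 / 2) (by norm_num)).and (hy (1 / 2) (by norm_num))).exists
  rw [connectedComponentIn_eq h1, connectedComponentIn_eq h2]

theorem wind_eq_of_mem (hf : SimpleChain n f) {x y : ℝ × ℝ}
    (h : y ∈ connectedComponentIn (trace f)ᶜ x) : wind n f y = wind n f x := by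
  have hc : ContinuousOn (wind n f) (connectedComponentIn (trace f)ᶜ x) :=
    continuousOn_of_eventually_eq fun z hz =>
      eventually_wind_eq hf.periodic (connectedComponentIn_subset _ _ hz)
  have hx : x ∈ (trace f)ᶜ := connectedComponentIn_nonempty_iff.1 ⟨y, h⟩
  exact isPreconnected_connectedComponentIn.constant hc h (mem_connectedComponentIn hx)

/-- The Jordan curve theorem for polygons, in terms of winding numbers. -/
theorem jordan (hf : SimpleChain n f) : ∃ σ : ℤ, (σ = 1 ∨ σ = -1) ∧
    (∀ x, x ∉ trace f → wind n f x = 0 ∨ wind n f x = σ) ∧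
    (∀ x, x ∉ trace f → (wind n f x ≠ 0 ↔ x ∈ enclosed (trace f))) ∧
    trace f ⊆ closure (enclosed (trace f)) := by
  obtain ⟨R, hR⟩ := exists_norm_le_of_periodic hf.periodic hf.pos
  have hR' : ∀ i, ‖f i‖ ≤ R := fun i => hR _ (vertex_mem_trace f i)
  have hR0 : 0 ≤ R := (norm_nonneg _).trans (hR' 0)
  have hfar : ∀ t : ℝ, 0 < t → R < ‖(R + t, (0 : ℝ))‖ := fun t ht => by
    refine lt_of_lt_of_le ?_ (norm_fst_le _)
    simp only [Real.norm_eq_abs]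
    exact lt_of_lt_of_le (by linarith) (le_abs_self _)
  have hsub : (fun t : ℝ => (R + t, (0 : ℝ))) '' Ioi 0 ⊆ (trace f)ᶜ := by
    rintro _ ⟨t, ht, rfl⟩ hm
    exact absurd (hR _ hm) (not_le.2 (hfar t ht))
  -- A base point in the unbounded component, where the winding number vanishes.
  set y₀ : ℝ × ℝ := (R + 1, 0) with hy₀
  have hy₀t : y₀ ∉ trace f := hsub ⟨1, mem_Ioi.2 one_pos, rfl⟩
  have hy₀w : wind n f y₀ = 0 := wind_eq_zero_of_far hf.periodic hR' (hfar 1 one_pos)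
  have hunb : ¬ Bornology.IsBounded (connectedComponentIn (trace f)ᶜ y₀) := by
    intro hb
    have hray : (fun t : ℝ => (R + t, (0 : ℝ))) '' Ioi 0 ⊆ connectedComponentIn (trace f)ᶜ y₀ :=
      (isPreconnected_Ioi.image _ (by fun_prop)).subset_connectedComponentIn
        ⟨1, mem_Ioi.2 one_pos, rfl⟩ hsub
    obtain ⟨M, hM⟩ := (hb.subset hray).exists_norm_le
    have h1 := hM _ ⟨|M| + 1, by have := abs_nonneg M; show (0:ℝ) < |M| + 1; linarith, rfl⟩
    have h2 := (norm_fst_le _).trans h1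
    simp only [Real.norm_eq_abs] at h2
    have h3 := (le_abs_self _).trans h2
    have h4 := le_abs_self M
    linarith
  have hbdd : ∀ x, x ∉ trace f → wind n f x ≠ 0 → x ∈ enclosed (trace f) := by
    intro x hx hw
    refine ⟨hx, (Metric.isBounded_closedBall (x := (0 : ℝ × ℝ)) (r := R)).subset fun z hz => ?_⟩
    rw [mem_closedBall_zero_iff]
    by_contra hz'
    exact hw ((hf.wind_eq_of_mem hz).symm.trans
      (wind_eq_zero_of_far hf.periodic hR' (not_le.1 hz')))
  -- A sign for each point off the chain; equal signs mean equal components, so there are at most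
  -- two components.
  choose! side hside1 hside2 using fun x (hx : x ∉ trace f) => hf.exists_side_component hx
  have hsame : ∀ x y, x ∉ trace f → y ∉ trace f → side x = side y →
      connectedComponentIn (trace f)ᶜ x = connectedComponentIn (trace f)ᶜ y := by
    intro x y hx hy h
    exact component_eq_of_side (hside2 x hx) (h ▸ hside2 y hy)
  have hwind : ∀ x y, x ∉ trace f → y ∉ trace f → side x = side y → wind n f x = wind n f y := by
    intro x y hx hy h
    refine hf.wind_eq_of_mem ?_
    rw [← hsame x y hx hy h]
    exact mem_connectedComponentIn hx
  have h2 : ∀ x y z, x ∉ trace f → y ∉ trace f → z ∉ trace f → side x ≠ side y →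
      side z = side x ∨ side z = side y := by
    intro x y z hx hy hz h
    have a := sq_eq_one_iff.1 (hside1 x hx)
    have b := sq_eq_one_iff.1 (hside1 y hy)
    have c := sq_eq_one_iff.1 (hside1 z hz)
    rcases a with a | a <;> rcases b with b | b <;> rcases c with c | c <;>
      simp [a, b, c] at h ⊢
  obtain ⟨x, y, hx, hy, hxy⟩ := hf.exists_wind_jump
  have hne : side x ≠ side y := fun h => by
    rw [hwind x y hx hy h] at hxy; simp at hxy
  -- The jump produces both signs, so one of its two points lies in the component other than that of
  -- `y₀`; its winding number is the constant `σ`.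
  obtain ⟨w, hw, hw0, hwσ⟩ : ∃ w, w ∉ trace f ∧ side w ≠ side y₀ ∧
      (wind n f w = 1 ∨ wind n f w = -1) := by
    rcases h2 x y y₀ hx hy hy₀t hne with h | h
    · refine ⟨y, hy, by rw [h]; exact hne.symm, ?_⟩
      rw [← hwind _ _ hy₀t hx h, hy₀w] at hxy
      omega
    · refine ⟨x, hx, by rw [h]; exact hne, ?_⟩
      rw [← hwind _ _ hy₀t hy h, hy₀w] at hxy
      omega
  refine ⟨wind n f w, hwσ, fun z hz => ?_, fun z hz => ⟨hbdd z hz, fun he h0 => ?_⟩, ?_⟩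
  · rcases h2 w y₀ z hw hy₀t hz hw0 with h | h
    · exact Or.inr (hwind _ _ hz hw h)
    · exact Or.inl ((hwind _ _ hz hy₀t h).trans hy₀w)
  · rcases h2 w y₀ z hw hy₀t hz hw0 with h | h
    · have := hwind _ _ hz hw h
      omega
    · exact hunb (hsame _ _ hz hy₀t h ▸ he.2)
  · refine (hf.trace_subset_closure (hside1 w hw) (absorbs_connectedComponentIn _ _)
      (hside2 w hw)).trans (closure_mono fun z hz => ?_)
    refine hbdd z (connectedComponentIn_subset _ _ hz) ?_
    rw [hf.wind_eq_of_mem hz]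
    omega

/-- Off the chain, being enclosed means having nonzero winding number, which is a locally constant
condition and fails far away; this gives the openness, closedness and boundedness. -/
theorem jordanSet (hf : SimpleChain n f) : JordanSet (trace f) := by
  obtain ⟨σ, hσ, h1, h2, h3⟩ := hf.jordan
  have hK := isCompact_trace hf.periodic hf.pos
  have hcl := hK.isClosed
  obtain ⟨R, hR⟩ := exists_norm_le_of_periodic hf.periodic hf.pos
  refine ⟨hK, ?_, ?_, ?_, ?_, h3⟩
  · exact measure_iUnion_null fun i => volume_segment_eq_zero _ _
  · refine isOpen_iff_eventually.2 fun x hx => ?_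
    filter_upwards [eventually_wind_eq hf.periodic hx.1, hcl.isOpen_compl.mem_nhds hx.1]
      with y hy hyt
    rw [← h2 y hyt, hy, h2 x hx.1]
    exact hx
  · refine (Metric.isBounded_closedBall (x := (0 : ℝ × ℝ)) (r := R)).subset fun z hz => ?_
    rw [mem_closedBall_zero_iff]
    by_contra hz'
    exact (h2 z hz.1).2 hz
      (wind_eq_zero_of_far hf.periodic (fun i => hR _ (vertex_mem_trace f i)) (not_le.1 hz'))
  · refine isOpen_compl_iff.1 (isOpen_iff_eventually.2 fun x hx => ?_)
    rw [mem_compl_iff, mem_union, not_or] at hx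
    filter_upwards [eventually_wind_eq hf.periodic hx.1, hcl.isOpen_compl.mem_nhds hx.1]
      with y hy hyt
    rw [mem_compl_iff, mem_union, not_or, ← h2 y hyt, hy, h2 x hx.1]
    exact ⟨hyt, hx.2⟩

end SimpleChain
end LatticePolygon

/-! ### Lattice point counts and additivity of the defect -/

namespace LatticePolygon
open Topology Set

theorem finite_lattice_inter {S : Set (ℝ × ℝ)} (hS : Bornology.IsBounded S) :
    (lattice ∩ S).Finite := by
  obtain ⟨R, hR⟩ := hS.exists_norm_le
  refine (((finite_Icc (-⌈R⌉) ⌈R⌉).prod (finite_Icc (-⌈R⌉) ⌈R⌉)).image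
    fun z : ℤ × ℤ => ((z.1 : ℝ), (z.2 : ℝ))).subset ?_
  rintro _ ⟨⟨z, rfl⟩, hz⟩
  have h := hR _ hz
  have h1 := abs_le.1 ((norm_fst_le _).trans h)
  have h2 := abs_le.1 ((norm_snd_le _).trans h)
  have hc := Int.le_ceil R
  refine ⟨z, ⟨⟨?_, ?_⟩, ?_, ?_⟩, rfl⟩ <;> (simp only at h1 h2; rify; linarith)

/-- The number of lattice points in `S`. -/
noncomputable def latticeCount (S : Set (ℝ × ℝ)) : ℝ := (lattice ∩ S).ncard

theorem latticeCount_union {S T : Set (ℝ × ℝ)} (hS : Bornology.IsBounded S)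
    (hT : Bornology.IsBounded T) (h : Disjoint S T) :
    latticeCount (S ∪ T) = latticeCount S + latticeCount T := by
  unfold latticeCount
  rw [inter_union_distrib_left, ncard_union_eq (h.mono inter_subset_right inter_subset_right)
    (finite_lattice_inter hS) (finite_lattice_inter hT), Nat.cast_add]

theorem latticeCount_pair {u w : ℝ × ℝ} (hu : u ∈ lattice) (hw : w ∈ lattice) (h : u ≠ w) :
    latticeCount {u, w} = 2 := by
  unfold latticeCount
  rw [inter_eq_right.2 (by rintro x (rfl | rfl) <;> assumption), ncard_pair h]
  norm_num

/-- The difference of the two sides of Pick's formula for the curve `B`. -/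
noncomputable def pickDefect (B : Set (ℝ × ℝ)) : ℝ :=
  volume.real (B ∪ enclosed B) - latticeCount B / 2 - latticeCount (enclosed B) + 1

theorem volume_union_of_null {S T : Set (ℝ × ℝ)} (hT : volume T = 0) :
    volume (S ∪ T) = volume S :=
  le_antisymm ((measure_union_le S T).trans (by rw [hT, add_zero]))
    (measure_mono subset_union_left)

theorem JordanSet.volume_real_union {B : Set (ℝ × ℝ)} (h : JordanSet B) :
    volume.real (B ∪ enclosed B) = volume.real (enclosed B) := by
  unfold Measure.real
  rw [union_comm, volume_union_of_null h.null]

/-- Three curves formed by pairs of three arcs with common endpoints: if `α ∪ β` encloses the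
disjoint union of what the other two curves enclose, then the defects in Pick's formula add. -/
theorem pickDefect_theta {α β γ : Set (ℝ × ℝ)} {u w : ℝ × ℝ} (hu : u ∈ lattice)
    (hw : w ∈ lattice) (huw : u ≠ w) (hX : JordanSet (α ∪ β)) (hY : JordanSet (α ∪ γ))
    (hZ : JordanSet (β ∪ γ)) (hαβ : α ∩ β = {u, w}) (hαγ : α ∩ γ = {u, w}) (hβγ : β ∩ γ = {u, w})
    (hrel : ∀ x, x ∉ α → x ∉ β → x ∉ γ → (x ∈ enclosed (α ∪ β) ↔
      x ∈ enclosed (α ∪ γ) ∨ x ∈ enclosed (β ∪ γ)) ∧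
      ¬ (x ∈ enclosed (α ∪ γ) ∧ x ∈ enclosed (β ∪ γ))) :
    pickDefect (α ∪ β) = pickDefect (α ∪ γ) + pickDefect (β ∪ γ) := by
  have hnull : volume (α ∪ β ∪ γ) = 0 :=
    measure_mono_null (fun x hx => by rcases hx with h | h; exacts [Or.inl h, Or.inr (Or.inr h)])
      (measure_union_null hX.null hZ.null)
  -- The relation between the enclosed sets is known only off the three arcs; these are null, so
  -- every nonempty open set contains points where it applies.
  have hdense : ∀ U : Set (ℝ × ℝ), IsOpen U → U.Nonempty →
      ∃ x ∈ U, x ∉ α ∧ x ∉ β ∧ x ∉ γ := by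
    intro U hU hne
    by_contra! h
    refine (hU.measure_pos volume hne).ne' (measure_mono_null (fun x hx => ?_) hnull)
    by_contra hc
    simp only [mem_union, not_or] at hc
    exact hc.2 (h x hx hc.1.1 hc.1.2)
  have hin : ∀ {B : Set (ℝ × ℝ)} {x}, x ∈ enclosed B → x ∉ B := fun h => h.1
  have hdisj : ∀ x, x ∈ enclosed (α ∪ γ) → x ∉ enclosed (β ∪ γ) := by
    intro x h1 h2
    obtain ⟨y, ⟨hy1, hy2⟩, ha, hb, hc⟩ := hdense _ (hY.isOpen_enclosed.inter hZ.isOpen_enclosed)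
      ⟨x, h1, h2⟩
    exact (hrel y ha hb hc).2 ⟨hy1, hy2⟩
  -- Otherwise a neighbourhood of `x` would avoid the closed region of `α ∪ β`, yet `x` is a limit
  -- of points enclosed by `α ∪ γ`, and a generic one of those is enclosed by `α ∪ β`.
  have hγX : ∀ x ∈ γ, x ∉ α → x ∉ β → x ∈ enclosed (α ∪ β) := by
    intro x hx ha hb
    by_contra hn
    obtain ⟨z, hz1, hz2⟩ := mem_closure_iff.1 (hY.subset_closure (Or.inr hx)) _
      hX.isClosed_union.isOpen_compl (show x ∈ (α ∪ β ∪ enclosed (α ∪ β))ᶜ by simp [ha, hb, hn])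
    obtain ⟨y, ⟨hy1, hy2⟩, ha', hb', hc'⟩ := hdense _
      (hX.isClosed_union.isOpen_compl.inter hY.isOpen_enclosed) ⟨z, hz1, hz2⟩
    exact hy1 (Or.inr ((hrel y ha' hb' hc').1.2 (Or.inl hy2)))
  -- A point of `α` is a limit of points enclosed by `α ∪ γ`, which cannot enter the disjoint open
  -- set enclosed by `β ∪ γ`.
  have hαZ : ∀ x ∈ α, x ∉ enclosed (β ∪ γ) := by
    intro x hx h
    obtain ⟨z, hz1, hz2⟩ := mem_closure_iff.1 (hY.subset_closure (Or.inl hx)) _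
      hZ.isOpen_enclosed h
    exact hdisj z hz2 hz1
  have hβY : ∀ x ∈ β, x ∉ enclosed (α ∪ γ) := by
    intro x hx h
    obtain ⟨z, hz1, hz2⟩ := mem_closure_iff.1 (hZ.subset_closure (Or.inl hx)) _
      hY.isOpen_enclosed h
    exact hdisj z hz1 hz2
  have huα : u ∈ α ∧ w ∈ α := by
    have h1 : u ∈ α ∩ β := by rw [hαβ]; simp
    have h2 : w ∈ α ∩ β := by rw [hαβ]; simp
    exact ⟨h1.1, h2.1⟩
  have huβ : u ∈ β ∧ w ∈ β := by
    have h1 : u ∈ α ∩ β := by rw [hαβ]; simp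
    have h2 : w ∈ α ∩ β := by rw [hαβ]; simp
    exact ⟨h1.2, h2.2⟩
  have huγ : u ∈ γ ∧ w ∈ γ := by
    have h1 : u ∈ α ∩ γ := by rw [hαγ]; simp
    have h2 : w ∈ α ∩ γ := by rw [hαγ]; simp
    exact ⟨h1.2, h2.2⟩
  have iαβ : ∀ x, x ∈ α → x ∈ β → x = u ∨ x = w := fun x h1 h2 => by
    have : x ∈ α ∩ β := ⟨h1, h2⟩
    rw [hαβ] at this; exact this
  have iαγ : ∀ x, x ∈ α → x ∈ γ → x = u ∨ x = w := fun x h1 h2 => by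
    have : x ∈ α ∩ γ := ⟨h1, h2⟩
    rw [hαγ] at this; exact this
  have iβγ : ∀ x, x ∈ β → x ∈ γ → x = u ∨ x = w := fun x h1 h2 => by
    have : x ∈ β ∩ γ := ⟨h1, h2⟩
    rw [hβγ] at this; exact this
  have hpair : ∀ x, x ∈ ({u, w} : Set (ℝ × ℝ)) ↔ x = u ∨ x = w := fun x => Iff.rfl
  have hIX : enclosed (α ∪ β) = enclosed (α ∪ γ) ∪ enclosed (β ∪ γ) ∪ (γ \ {u, w}) := by
    ext x
    simp only [mem_union, mem_sdiff, hpair]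
    by_cases hxα : x ∈ α
    · have h1 : x ∉ enclosed (α ∪ β) := fun h => hin h (Or.inl hxα)
      have h2 : x ∉ enclosed (α ∪ γ) := fun h => hin h (Or.inl hxα)
      have h3 := hαZ x hxα
      have h4 := iαγ x hxα
      exact iff_of_false h1 fun h => h.elim (fun h => h.elim h2 h3) fun h => h.2 (h4 h.1)
    by_cases hxβ : x ∈ β
    · have h1 : x ∉ enclosed (α ∪ β) := fun h => hin h (Or.inr hxβ)
      have h2 : x ∉ enclosed (β ∪ γ) := fun h => hin h (Or.inl hxβ)
      have h3 := hβY x hxβ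
      have h4 := iβγ x hxβ
      exact iff_of_false h1 fun h => h.elim (fun h => h.elim h3 h2) fun h => h.2 (h4 h.1)
    by_cases hxγ : x ∈ γ
    · have h1 := hγX x hxγ hxα hxβ
      have h2 : ¬ (x = u ∨ x = w) := by
        rintro (rfl | rfl)
        exacts [hxα huα.1, hxα huα.2]
      exact iff_of_true h1 (Or.inr ⟨hxγ, h2⟩)
    · rw [(hrel x hxα hxβ hxγ).1]
      exact ⟨Or.inl, fun h => h.elim id fun h => absurd h.1 hxγ⟩
  have bα : Bornology.IsBounded α := hX.isCompact.isBounded.subset subset_union_left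
  have bβ : Bornology.IsBounded β := hX.isCompact.isBounded.subset subset_union_right
  have bγ : Bornology.IsBounded γ := hY.isCompact.isBounded.subset subset_union_right
  have bγ' : Bornology.IsBounded (γ \ {u, w}) := bγ.subset sdiff_subset
  have bα' : Bornology.IsBounded (α \ {u, w}) := bα.subset sdiff_subset
  have bβ' : Bornology.IsBounded (β \ {u, w}) := bβ.subset sdiff_subset
  have bp : Bornology.IsBounded ({u, w} : Set (ℝ × ℝ)) := (toFinite _).isBounded
  have hboundary : ∀ S T : Set (ℝ × ℝ), Bornology.IsBounded S → Bornology.IsBounded T →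
      S ∩ T = {u, w} →
      latticeCount (S ∪ T) = latticeCount (S \ {u, w}) + latticeCount (T \ {u, w}) + 2 := by
    intro S T hS hT hST
    have e : S ∪ T = S \ {u, w} ∪ T \ {u, w} ∪ {u, w} := by
      rw [← hST]; ext x; simp only [mem_union, mem_sdiff, mem_inter_iff]; tauto
    have d1 : Disjoint (S \ {u, w}) (T \ {u, w}) := by
      rw [← hST, Set.disjoint_left]
      rintro x ⟨h1, h2⟩ ⟨h3, -⟩
      exact h2 ⟨h1, h3⟩
    have d2 : Disjoint (S \ {u, w} ∪ T \ {u, w}) {u, w} := by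
      rw [Set.disjoint_left]
      rintro x (⟨-, h⟩ | ⟨-, h⟩) h' <;> exact h h'
    have b1 : Bornology.IsBounded (S \ {u, w}) := hS.subset sdiff_subset
    have b2 : Bornology.IsBounded (T \ {u, w}) := hT.subset sdiff_subset
    rw [e, latticeCount_union (b1.union b2) bp d2, latticeCount_union b1 b2 d1,
      latticeCount_pair hu hw huw]
  have hYZ : Disjoint (enclosed (α ∪ γ)) (enclosed (β ∪ γ)) := Set.disjoint_left.2 hdisj
  have hYZγ : Disjoint (enclosed (α ∪ γ) ∪ enclosed (β ∪ γ)) (γ \ {u, w}) := by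
    rw [Set.disjoint_left]
    rintro x (h | h) hx
    · exact hin h (Or.inr hx.1)
    · exact hin h (Or.inr hx.1)
  have cX : latticeCount (enclosed (α ∪ β)) = latticeCount (enclosed (α ∪ γ)) +
      latticeCount (enclosed (β ∪ γ)) + latticeCount (γ \ {u, w}) := by
    rw [hIX, latticeCount_union (hY.isBounded_enclosed.union hZ.isBounded_enclosed) bγ' hYZγ,
      latticeCount_union hY.isBounded_enclosed hZ.isBounded_enclosed hYZ]
  have nγ : volume (γ \ {u, w}) = 0 := measure_mono_null (fun x hx => Or.inr hx.1) hnull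
  have vX : volume.real (enclosed (α ∪ β)) = volume.real (enclosed (α ∪ γ)) +
      volume.real (enclosed (β ∪ γ)) := by
    have : volume (enclosed (α ∪ β)) = volume (enclosed (α ∪ γ) ∪ enclosed (β ∪ γ)) := by
      rw [hIX, volume_union_of_null nγ]
    unfold Measure.real
    rw [this, measure_union hYZ hZ.isOpen_enclosed.measurableSet,
      ENNReal.toReal_add hY.isBounded_enclosed.measure_lt_top.ne
        hZ.isBounded_enclosed.measure_lt_top.ne]
  -- A lattice point of `γ` other than `u` and `w` counts once inside `α ∪ β`, or one half on each
  -- of the other two curves. On every curve `u` and `w` together count one, which cancels the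
  -- constant `1`.
  unfold pickDefect
  rw [hX.volume_real_union, hY.volume_real_union, hZ.volume_real_union, vX, cX,
    hboundary α β bα bβ hαβ, hboundary α γ bα bγ hαγ, hboundary β γ bβ bγ hβγ]
  ring

end LatticePolygon

/-! ### Cutting a simple chain along a chord -/

namespace LatticePolygon
open Filter Topology Set
variable {n : ℕ} {f : ℕ → ℝ × ℝ}

/-- To check that a periodic chain is simple, it suffices to consider one period. -/
theorem SimpleChain.of_lt (hn : 3 ≤ n) (hp : ∀ i, f (i + n) = f i)
    (hne : ∀ i, i < n → f i ≠ f (i + 1))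
    (hi : ∀ i j x, i < j → j < n → x ∈ segment ℝ (f i) (f (i + 1)) →
      x ∈ segment ℝ (f j) (f (j + 1)) → (j = i + 1 ∧ x = f j) ∨ (i = 0 ∧ j + 1 = n ∧ x = f 0)) :
    SimpleChain n f := by
  have e1 : ∀ i, f i = f (i % n) := fun i => (apply_mod_of_periodic hp i).symm
  have e2 : ∀ i, f (i + 1) = f (i % n + 1) := fun i => (apply_mod_succ_of_periodic hp i).symm
  have hlt : ∀ i, i % n < n := fun i => Nat.mod_lt _ (by omega)
  refine ⟨hn, hp, fun i => ?_, fun i j x hij hjn hx1 hx2 => ?_⟩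
  · rw [e1 i, e2 i]; exact hne _ (hlt i)
  · have a1 := Nat.div_add_mod i n
    have a2 := Nat.div_add_mod j n
    have b1 := hlt i
    have b2 := hlt j
    rw [e1 i, e2 i] at hx1
    rw [e1 j, e2 j] at hx2
    rw [e1 j, e1 i]
    obtain ⟨q, hq⟩ : ∃ q, q = i / n := ⟨_, rfl⟩
    obtain ⟨q', hq'⟩ : ∃ q, q = j / n := ⟨_, rfl⟩
    rw [← hq] at a1
    rw [← hq'] at a2
    generalize i % n = i' at *
    generalize j % n = j' at *
    -- Indices less than one period apart lie in the same period or in consecutive ones; in the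
    -- second case reduction modulo `n` reverses their order.
    have hqq : q' = q ∨ q' = q + 1 := by
      have h1 : q ≤ q' := by
        by_contra h
        have : n * (q' + 1) ≤ n * q := Nat.mul_le_mul_left _ (by omega)
        rw [mul_add, mul_one] at this
        omega
      have h2 : q' ≤ q + 1 := by
        by_contra h
        have : n * (q + 2) ≤ n * q' := Nat.mul_le_mul_left _ (by omega)
        rw [mul_add] at this
        omega
      omega
    rcases hqq with rfl | rfl
    · rcases hi i' j' x (by omega) b2 hx1 hx2 with ⟨h, h'⟩ | ⟨h, h', h''⟩
      · exact Or.inl ⟨by omega, h'⟩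
      · exact Or.inr ⟨by omega, by rw [h'', h]⟩
    · rw [mul_add, mul_one] at a2
      rcases hi j' i' x (by omega) b1 hx2 hx1 with ⟨h, h'⟩ | ⟨h, h', h''⟩
      · exact Or.inr ⟨by omega, h'⟩
      · exact Or.inl ⟨by omega, by rw [h'', h]⟩

/-- The closed chain made of `l` consecutive sides of `f`, starting at the vertex `f a`, and the
chord back to `f a`. -/
def subchain (f : ℕ → ℝ × ℝ) (a l : ℕ) : ℕ → ℝ × ℝ := fun i => f (a + i % (l + 1))

/-- The union of `l` consecutive sides of `f`, starting at the vertex `f a`. -/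
def arc (f : ℕ → ℝ × ℝ) (a l : ℕ) : Set (ℝ × ℝ) :=
  ⋃ i ∈ Finset.range l, segment ℝ (f (a + i)) (f (a + i + 1))

theorem mem_arc {a l : ℕ} {x : ℝ × ℝ} :
    x ∈ arc f a l ↔ ∃ i < l, x ∈ segment ℝ (f (a + i)) (f (a + i + 1)) := by
  simp [arc]

theorem subchain_periodic (f : ℕ → ℝ × ℝ) (a l i : ℕ) :
    subchain f a l (i + (l + 1)) = subchain f a l i := by simp [subchain]

theorem subchain_apply {a l i : ℕ} (h : i ≤ l) : subchain f a l i = f (a + i) := by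
  rw [subchain, Nat.mod_eq_of_lt (by omega)]

theorem subchain_last (f : ℕ → ℝ × ℝ) (a l : ℕ) : subchain f a l (l + 1) = f a := by
  simp [subchain]

theorem trace_subchain (f : ℕ → ℝ × ℝ) (a l : ℕ) :
    trace (subchain f a l) = arc f a l ∪ segment ℝ (f a) (f (a + l)) := by
  rw [trace_eq_biUnion (subchain_periodic f a l) (by omega), Finset.range_add_one,
    Finset.set_biUnion_insert, subchain_apply le_rfl, subchain_last, segment_symm, union_comm]
  congr 1
  ext x
  rw [mem_arc]
  simp only [mem_iUnion, Finset.mem_range, exists_prop]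
  refine exists_congr fun i => and_congr_right fun hi => ?_
  rw [subchain_apply hi.le, subchain_apply hi, add_assoc]

theorem wind_subchain (f : ℕ → ℝ × ℝ) (a l : ℕ) (x : ℝ × ℝ) :
    wind (l + 1) (subchain f a l) x =
      ∑ i ∈ Finset.range l, crossing (f (a + i)) (f (a + i + 1)) x + crossing (f (a + l)) (f a) x := by
  rw [wind, Finset.sum_range_succ, subchain_apply le_rfl, subchain_last]
  congr 1
  refine Finset.sum_congr rfl fun i hi => ?_
  have hi := Finset.mem_range.1 hi
  rw [subchain_apply hi.le, subchain_apply hi, add_assoc]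

theorem arc_subset_trace (f : ℕ → ℝ × ℝ) (a l : ℕ) : arc f a l ⊆ trace f := fun x hx => by
  obtain ⟨i, -, h⟩ := mem_arc.1 hx
  exact segment_subset_trace f _ h

namespace SimpleChain

theorem subchain (hf : SimpleChain n f) {a l : ℕ} (h2 : 2 ≤ l) (hl : l + 2 ≤ n)
    (hne : f a ≠ f (a + l))
    (hc : segment ℝ (f a) (f (a + l)) ∩ trace f ⊆ {f a, f (a + l)}) :
    SimpleChain (l + 1) (subchain f a l) := by
  refine SimpleChain.of_lt (by omega) (subchain_periodic f a l) (fun i hi => ?_)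
    (fun i j x hij hj hx1 hx2 => ?_)
  · rcases (Nat.lt_succ_iff.1 hi).lt_or_eq with h | rfl
    · rw [subchain_apply h.le, subchain_apply h]; exact hf.ne _
    · rw [subchain_apply le_rfl, subchain_last]; exact hne.symm
  · have hil : i < l := by omega
    rw [subchain_apply hil.le, subchain_apply (show i + 1 ≤ l from hil), ← add_assoc] at hx1
    rcases (Nat.lt_succ_iff.1 hj).lt_or_eq with h | rfl
    · rw [subchain_apply h.le, subchain_apply (show j + 1 ≤ l from h), ← add_assoc] at hx2
      rw [subchain_apply h.le]
      rcases hf.inter (a + i) (a + j) x (by omega) (by omega) hx1 hx2 with ⟨h', h''⟩ | ⟨h', -⟩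
      · exact Or.inl ⟨by omega, h''⟩
      · omega
    · rw [subchain_apply le_rfl, subchain_last, segment_symm] at hx2
      rw [subchain_apply le_rfl, subchain_apply (Nat.zero_le _), add_zero]
      rcases hc ⟨hx2, segment_subset_trace f _ hx1⟩ with rfl | rfl
      · rcases Nat.eq_zero_or_pos i with rfl | hi
        · exact Or.inr ⟨rfl, rfl, rfl⟩
        · rcases hf.inter a (a + i) _ (by omega) (by omega) (left_mem_segment _ _ _) hx1 with
            ⟨h1, h2⟩ | ⟨h1, -⟩
          · rw [h1] at h2
            exact absurd h2 (hf.ne a)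
          · omega
      · rcases (show i + 1 ≤ j by omega).lt_or_eq with h | h
        · obtain ⟨m, rfl⟩ : ∃ m, j = m + 1 := ⟨j - 1, by omega⟩
          rcases hf.inter (a + i) (a + m) _ (by omega) (by omega) hx1
            (right_mem_segment _ _ _) with ⟨h1, h2⟩ | ⟨h1, -⟩
          · exact absurd h2.symm (hf.ne _)
          · omega
        · exact Or.inl ⟨h.symm, rfl⟩

/-- The two subchains run along the chord in opposite directions, so its crossings cancel and the
winding numbers add. The signs then decide which of the three curves encloses the other two regions.
-/
theorem pickDefect_eq_zero_of_chord (hf : SimpleChain n f) {k : ℕ} (h2 : 2 ≤ k) (hk : k + 2 ≤ n)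
    (h0 : f 0 ∈ lattice) (hkl : f k ∈ lattice) (hne : f 0 ≠ f k)
    (hc : segment ℝ (f 0) (f k) ∩ trace f ⊆ {f 0, f k})
    (d1 : pickDefect (trace (LatticePolygon.subchain f 0 k)) = 0)
    (d2 : pickDefect (trace (LatticePolygon.subchain f k (n - k))) = 0) :
    pickDefect (trace f) = 0 := by
  have hn0 : f n = f 0 := by rw [← hf.periodic 0, zero_add]
  have ekn : k + (n - k) = n := by omega
  have s1 := hf.subchain (a := 0) h2 hk (by rwa [zero_add]) (by rwa [zero_add])
  have s2 := hf.subchain (a := k) (l := n - k) (by omega) (by omega)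
    (by rw [ekn, hn0]; exact hne.symm)
    (by rw [ekn, hn0, segment_symm, pair_comm]; exact hc)
  have t1 := trace_subchain f 0 k
  have t2 := trace_subchain f k (n - k)
  rw [zero_add] at t1
  rw [ekn, hn0, segment_symm] at t2
  have t : trace f = arc f 0 k ∪ arc f k (n - k) := by
    refine Subset.antisymm (fun x hx => ?_)
      (union_subset (arc_subset_trace _ _ _) (arc_subset_trace _ _ _))
    obtain ⟨i, -, hi, hxi⟩ := exists_lt_of_mem_trace hf.periodic hf.pos 0 hx
    rcases lt_or_ge i k with h | h
    · exact Or.inl (mem_arc.2 ⟨i, h, by rwa [zero_add]⟩)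
    · exact Or.inr (mem_arc.2 ⟨i - k, by omega, by rwa [show k + (i - k) = i by omega]⟩)
  have hw : ∀ x, wind n f x = wind (k + 1) (LatticePolygon.subchain f 0 k) x +
      wind (n - k + 1) (LatticePolygon.subchain f k (n - k)) x := by
    intro x
    rw [wind_subchain, wind_subchain, ekn, hn0, zero_add, crossing_swap (f 0) (f k), wind]
    conv_lhs => rw [← ekn, Finset.sum_range_add]
    simp only [zero_add]
    ring
  obtain ⟨σ, hσ, hσ1, hσ2, -⟩ := hf.jordan
  obtain ⟨τ, hτ, hτ1, hτ2, -⟩ := s1.jordan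
  obtain ⟨ρ, hρ, hρ1, hρ2, -⟩ := s2.jordan
  have J := hf.jordanSet
  have J1 := s1.jordanSet
  have J2 := s2.jordanSet
  rw [t] at J hσ1 hσ2 ⊢
  rw [t1] at J1 hτ1 hτ2 d1
  rw [t2] at J2 hρ1 hρ2 d2
  have m0 : f 0 ∈ arc f 0 k := mem_arc.2 ⟨0, by omega, left_mem_segment _ _ _⟩
  have mk : f k ∈ arc f 0 k := mem_arc.2 ⟨k - 1, by omega, by
    rw [zero_add, show k - 1 + 1 = k by omega]; exact right_mem_segment _ _ _⟩
  have m0' : f 0 ∈ arc f k (n - k) := mem_arc.2 ⟨n - k - 1, by omega, by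
    rw [show k + (n - k - 1) + 1 = n by omega, hn0]; exact right_mem_segment _ _ _⟩
  have mk' : f k ∈ arc f k (n - k) := mem_arc.2 ⟨0, by omega, left_mem_segment _ _ _⟩
  have iαβ : arc f 0 k ∩ arc f k (n - k) = {f 0, f k} := by
    refine Subset.antisymm ?_ (pair_subset ⟨m0, m0'⟩ ⟨mk, mk'⟩)
    rintro x ⟨h1, h2⟩
    obtain ⟨i, hi, hxi⟩ := mem_arc.1 h1
    obtain ⟨j, hj, hxj⟩ := mem_arc.1 h2
    rw [zero_add] at hxi
    rcases hf.inter i (k + j) x (by omega) (by omega) hxi hxj with ⟨h, h'⟩ | ⟨h, h'⟩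
    · exact Or.inr (by rw [h', show k + j = k by omega]; rfl)
    · exact Or.inl (by rw [h', show i = 0 by omega])
  have iαγ : arc f 0 k ∩ segment ℝ (f 0) (f k) = {f 0, f k} := by
    refine Subset.antisymm ?_ (pair_subset ⟨m0, left_mem_segment _ _ _⟩
      ⟨mk, right_mem_segment _ _ _⟩)
    rintro x ⟨h1, h2⟩
    exact hc ⟨h2, arc_subset_trace _ _ _ h1⟩
  have iβγ : arc f k (n - k) ∩ segment ℝ (f 0) (f k) = {f 0, f k} := by
    refine Subset.antisymm ?_ (pair_subset ⟨m0', left_mem_segment _ _ _⟩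
      ⟨mk', right_mem_segment _ _ _⟩)
    rintro x ⟨h1, h2⟩
    exact hc ⟨h2, arc_subset_trace _ _ _ h1⟩
  generalize arc f 0 k = α at *
  generalize arc f k (n - k) = β at *
  generalize segment ℝ (f 0) (f k) = γ at *
  have key : ∀ x, x ∉ α → x ∉ β → x ∉ γ →
      ∃ a b c : ℤ, a = b + c ∧ (a = 0 ∨ a = σ) ∧ (b = 0 ∨ b = τ) ∧ (c = 0 ∨ c = ρ) ∧
        (x ∈ enclosed (α ∪ β) ↔ a ≠ 0) ∧ (x ∈ enclosed (α ∪ γ) ↔ b ≠ 0) ∧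
        (x ∈ enclosed (β ∪ γ) ↔ c ≠ 0) := by
    intro x ha hb hc
    have n1 : x ∉ α ∪ β := fun h => h.elim ha hb
    have n2 : x ∉ α ∪ γ := fun h => h.elim ha hc
    have n3 : x ∉ β ∪ γ := fun h => h.elim hb hc
    exact ⟨_, _, _, hw x, hσ1 x n1, hτ1 x n2, hρ1 x n3, (hσ2 x n1).symm, (hτ2 x n2).symm,
      (hρ2 x n3).symm⟩
  -- Equal signs: a point enclosed by both subchains would have winding number `2 * τ`, which is
  -- impossible, so the regions are disjoint and make up that of `f`.
  by_cases hτρ : τ = ρ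
  · have := pickDefect_theta h0 hkl hne J J1 J2 iαβ iαγ iβγ fun x ha hb hc => by
      obtain ⟨a, b, c, habc, h1, h2, h3, e1, e2, e3⟩ := key x ha hb hc
      rw [e1, e2, e3]
      omega
    linarith
  -- Opposite signs: the curve whose sign differs from the other two is subtracted, so moving it
  -- across `a = b + c` shows that one of the subchains is the outer curve.
  · by_cases hστ : σ = τ
    · have := pickDefect_theta (α := α) (β := γ) (γ := β) h0 hkl hne J1 J
        (by rwa [union_comm]) iαγ iαβ (by rwa [inter_comm]) fun x ha hb hc => by
          obtain ⟨a, b, c, habc, h1, h2, h3, e1, e2, e3⟩ := key x ha hc hb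
          rw [union_comm γ β, e1, e2, e3]
          omega
      rw [union_comm γ β] at this
      linarith
    · have := pickDefect_theta (α := β) (β := γ) (γ := α) h0 hkl hne J2
        (by rwa [union_comm]) (by rwa [union_comm]) iβγ (by rwa [inter_comm])
        (by rwa [inter_comm]) fun x ha hb hc => by
          obtain ⟨a, b, c, habc, h1, h2, h3, e1, e2, e3⟩ := key x hc ha hb
          rw [union_comm γ α, union_comm β α, e1, e2, e3]
          omega
      rw [union_comm γ α, union_comm β α] at this
      linarith

theorem shift (hf : SimpleChain n f) (m : ℕ) : SimpleChain n fun i => f (i + m) := by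
  refine ⟨hf.three_le, fun i => ?_, fun i => ?_, fun i j x hij hj h1 h2 => ?_⟩
  · show f (i + n + m) = f (i + m)
    rw [add_right_comm, hf.periodic]
  · show f (i + m) ≠ f (i + 1 + m)
    rw [add_right_comm]; exact hf.ne _
  · rw [add_right_comm] at h1 h2
    rcases hf.inter (i + m) (j + m) x (by omega) (by omega) h1 h2 with ⟨h, h'⟩ | ⟨h, h'⟩
    · exact Or.inl ⟨by omega, h'⟩
    · exact Or.inr ⟨by omega, h'⟩

theorem trace_shift (hf : SimpleChain n f) (m : ℕ) : trace (fun i => f (i + m)) = trace f := by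
  refine Subset.antisymm (fun x hx => ?_) fun x hx => ?_
  · obtain ⟨i, hi⟩ := mem_iUnion.1 hx
    simp only [add_right_comm i 1 m] at hi
    exact segment_subset_trace f _ hi
  · obtain ⟨i, h1, -, h3⟩ := exists_lt_of_mem_trace hf.periodic hf.pos m hx
    refine mem_iUnion.2 ⟨i - m, ?_⟩
    simp only [add_right_comm _ 1 m]
    simpa [show i - m + m = i by omega] using h3

end SimpleChain
end LatticePolygon

/-! ### Existence of a chord -/

namespace LatticePolygon
open Filter Topology Set
variable {n : ℕ} {f : ℕ → ℝ × ℝ}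

/-- `S` and `T` are the affine coordinates with origin `v` and unit points `a` and `b`. -/
structure AffineCoords (v a b : ℝ × ℝ) (S T : ℝ × ℝ → ℝ) : Prop where
  fst_line : ∀ p q (τ : ℝ), S (p + τ • (q - p)) = S p + τ * (S q - S p)
  snd_line : ∀ p q (τ : ℝ), T (p + τ • (q - p)) = T p + τ * (T q - T p)
  fst_add : ∀ x (s t : ℝ), S (x + s • (a - v) + t • (b - v)) = S x + s
  snd_add : ∀ x (s t : ℝ), T (x + s • (a - v) + t • (b - v)) = T x + t
  eq : ∀ x, x = v + S x • (a - v) + T x • (b - v)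
  fst_left : S a = 1
  snd_left : T a = 0
  fst_right : S b = 0
  snd_right : T b = 1
  fst_origin : S v = 0
  snd_origin : T v = 0
  continuous_fst : Continuous S
  continuous_snd : Continuous T

theorem exists_affineCoords {v a b : ℝ × ℝ} (h : cross (a - v) (b - v) ≠ 0) :
    ∃ S T, AffineCoords v a b S T := by
  refine ⟨fun x => cross (x - v) (b - v) / cross (a - v) (b - v),
    fun x => cross (a - v) (x - v) / cross (a - v) (b - v),
    fun p q τ => ?_, fun p q τ => ?_, fun x s t => ?_, fun x s t => ?_, fun x => ?_, div_self h, ?_, ?_, div_self h, ?_, ?_, ?_, ?_⟩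
  · field_simp; simp [cross]; ring
  · field_simp; simp [cross]; ring
  · field_simp; simp [cross]; ring
  · field_simp; simp [cross]; ring
  · ext
    · simp only [Prod.fst_add, Prod.smul_fst, smul_eq_mul]
      field_simp
      simp [cross]; ring
    · simp only [Prod.snd_add, Prod.smul_snd, smul_eq_mul]
      field_simp
      simp [cross]; ring
  · simp [cross, mul_comm]
  · simp [cross, mul_comm]
  · simp [cross]
  · simp [cross]
  · unfold cross; fun_prop
  · unfold cross; fun_prop

namespace AffineCoords
variable {v a b : ℝ × ℝ} {S T : ℝ × ℝ → ℝ}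

theorem mem_right (h : AffineCoords v a b S T) {x : ℝ × ℝ} (h0 : S x = 0) (h1 : 0 ≤ T x)
    (h2 : T x ≤ 1) : x ∈ segment ℝ v b :=
  mem_segment_iff_exists.2 ⟨T x, ⟨h1, h2⟩, by
    conv_lhs => rw [h.eq x, h0, zero_smul, add_zero]⟩

theorem mem_left (h : AffineCoords v a b S T) {x : ℝ × ℝ} (h0 : T x = 0) (h1 : 0 ≤ S x)
    (h2 : S x ≤ 1) : x ∈ segment ℝ a v := by
  rw [segment_symm]
  exact mem_segment_iff_exists.2 ⟨S x, ⟨h1, h2⟩, by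
    conv_lhs => rw [h.eq x, h0, zero_smul, add_zero]⟩

theorem fst_eq_zero_of_mem (h : AffineCoords v a b S T) {x : ℝ × ℝ} (hx : x ∈ segment ℝ v b) :
    S x = 0 := by
  obtain ⟨t, -, rfl⟩ := mem_segment_iff_exists.1 hx
  rw [h.fst_line, h.fst_origin, h.fst_right]; simp

theorem snd_eq_zero_of_mem (h : AffineCoords v a b S T) {x : ℝ × ℝ} (hx : x ∈ segment ℝ a v) :
    T x = 0 := by
  obtain ⟨t, -, rfl⟩ := mem_segment_iff_exists.1 hx
  rw [h.snd_line, h.snd_origin, h.snd_left]; simp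

theorem ext (h : AffineCoords v a b S T) {x y : ℝ × ℝ} (h1 : S x = S y) (h2 : T x = T y) :
    x = y := by rw [h.eq x, h.eq y, h1, h2]

end AffineCoords

/-- A segment leaving the open quadrant first hits an axis; the sign of `s * t' - t * s'`, here in
expanded form, tells which coordinate vanishes first. -/
theorem exists_first_zero {s t s' t' : ℝ} (hs : 0 < s) (ht : 0 < t) (h : s' < 0 ∨ t' < 0) :
    ∃ τ, 0 < τ ∧ τ ≤ 1 ∧ ((s + τ * (s' - s) = 0 ∧ 0 ≤ t + τ * (t' - t)) ∨
      (t + τ * (t' - t) = 0 ∧ 0 ≤ s + τ * (s' - s))) := by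
  have main : ∀ {s t s' t' : ℝ}, 0 < s → 0 < t → s' < 0 → 0 ≤ t * (s - s') + s * (t' - t) →
      ∃ τ, 0 < τ ∧ τ ≤ 1 ∧ s + τ * (s' - s) = 0 ∧ 0 ≤ t + τ * (t' - t) := by
    intro s t s' t' hs ht hs' h
    have h0 : 0 < s - s' := by linarith
    refine ⟨s / (s - s'), by positivity, (div_le_one h0).2 (by linarith), by field_simp; ring, ?_⟩
    have : t + s / (s - s') * (t' - t) = (t * (s - s') + s * (t' - t)) / (s - s') := by
      field_simp
    rw [this]
    positivity
  rcases le_total 0 (t * (s - s') + s * (t' - t)) with h1 | h1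
  · by_cases hs' : s' < 0
    · obtain ⟨τ, a, b, c, d⟩ := main hs ht hs' h1
      exact ⟨τ, a, b, Or.inl ⟨c, d⟩⟩
    · have ht' := h.resolve_left hs'
      nlinarith
  · by_cases ht' : t' < 0
    · obtain ⟨τ, a, b, c, d⟩ := main (t' := s') ht hs ht' (by linarith)
      exact ⟨τ, a, b, Or.inr ⟨c, d⟩⟩
    · have hs' := h.resolve_right ht'
      nlinarith

namespace SimpleChain

variable {S T : ℝ × ℝ → ℝ}

/-- No side away from the vertex `f 1` leaves the angle at `f 1` through the two adjacent sides. -/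
theorem not_leave_angle (hf : SimpleChain n f) (hST : AffineCoords (f 1) (f 0) (f 2) S T) {j : ℕ}
    (h2 : 2 ≤ j) (hj : j < n) {x y : ℝ × ℝ} (hx : x ∈ segment ℝ (f j) (f (j + 1)))
    (hy : y ∈ segment ℝ (f j) (f (j + 1))) (hs : 0 < S x) (ht : 0 < T x) (hhx : S x + T x ≤ 1)
    (hhy : S y + T y < 1) (hout : S y < 0 ∨ T y < 0) : False := by
  obtain ⟨τ, h0, h1, h⟩ := exists_first_zero hs ht hout
  have hz : x + τ • (y - x) ∈ segment ℝ (f j) (f (j + 1)) :=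
    (convex_segment _ _).add_smul_sub_mem hx hy ⟨h0.le, h1⟩
  have hsum : S (x + τ • (y - x)) + T (x + τ • (y - x)) < 1 := by
    rw [hST.fst_line, hST.snd_line]; nlinarith
  rw [← hST.fst_line, ← hST.snd_line] at h
  generalize x + τ • (y - x) = z at *
  rcases h with ⟨h, h'⟩ | ⟨h, h'⟩
  · rcases hf.inter 1 j z (by omega) (by omega) (hST.mem_right h h' (by linarith)) hz with
      ⟨e, e'⟩ | ⟨e, -⟩
    · rw [e] at e'
      rw [e', hST.fst_right, hST.snd_right] at hsum
      linarith
    · omega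
  · rcases hf.inter 0 j z (by omega) (by omega) (hST.mem_left h h' (by linarith)) hz with
      ⟨e, -⟩ | ⟨-, e⟩
    · omega
    · rw [e, hST.fst_left, hST.snd_left] at hsum
      linarith

/-- `U` collects the other vertices in the closed triangle `f 0`, `f 1`, `f 2`. If there are none,
the chord from `f 0` to `f 2` works. Otherwise one joins `f 1` to a vertex of `U` minimizing `S +
T`, that is, farthest from the line through `f 0` and `f 2`. A side meeting the chord would have to
leave the angle at `f 1` through its legs. -/
theorem exists_chord_of_coords (hf : SimpleChain n f) (hn : 4 ≤ n)
    (hST : AffineCoords (f 1) (f 0) (f 2) S T) :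
    ∃ a k, 2 ≤ k ∧ k + 2 ≤ n ∧ f a ≠ f (a + k) ∧
      segment ℝ (f a) (f (a + k)) ∩ trace f ⊆ {f a, f (a + k)} := by
  classical
  have hn0 : f n = f 0 := by rw [← hf.periodic 0, zero_add]
  set U := (Finset.Icc 3 (n - 1)).filter fun k => 0 ≤ S (f k) ∧ 0 ≤ T (f k) ∧ S (f k) + T (f k) ≤ 1
    with hU
  have hmem : ∀ k, k ∈ U ↔ (3 ≤ k ∧ k + 1 ≤ n) ∧ 0 ≤ S (f k) ∧ 0 ≤ T (f k) ∧
      S (f k) + T (f k) ≤ 1 := fun k => by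
    rw [hU, Finset.mem_filter, Finset.mem_Icc]
    refine and_congr_left fun _ => ?_
    omega
  rcases U.eq_empty_or_nonempty with hemp | hne
  · have hout : ∀ m, 3 ≤ m → m + 1 ≤ n → S (f m) + T (f m) ≤ 1 → S (f m) < 0 ∨ T (f m) < 0 := by
      intro m h1 h2 h3
      by_contra! hcon
      have : m ∈ U := (hmem m).2 ⟨⟨h1, h2⟩, hcon.1, hcon.2, h3⟩
      rw [hemp] at this
      simp at this
    refine ⟨0, 2, le_rfl, by omega, fun h => ?_, ?_⟩
    · have h1 := hST.fst_left
      rw [h, zero_add, hST.fst_right] at h1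
      norm_num at h1
    rintro x ⟨hx, hxt⟩
    rw [zero_add] at hx ⊢
    obtain ⟨τ, hτ, rfl⟩ := mem_segment_iff_exists.1 hx
    rcases hτ.1.lt_or_eq with hτ0 | rfl
    swap
    · simp
    rcases hτ.2.lt_or_eq with hτ1 | rfl
    swap
    · simp
    exfalso
    have hSx : S (f 0 + τ • (f 2 - f 0)) = 1 - τ := by
      rw [hST.fst_line, hST.fst_left, hST.fst_right]; ring
    have hTx : T (f 0 + τ • (f 2 - f 0)) = τ := by
      rw [hST.snd_line, hST.snd_left, hST.snd_right]; ring
    generalize f 0 + τ • (f 2 - f 0) = x at *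
    obtain ⟨j, -, hj, hxj⟩ := exists_lt_of_mem_trace hf.periodic hf.pos 0 hxt
    rw [zero_add] at hj
    have hj2 : 2 ≤ j := by
      by_contra hj2
      have : j = 0 ∨ j = 1 := by omega
      rcases this with rfl | rfl
      · have := hST.snd_eq_zero_of_mem hxj
        linarith
      · have := hST.fst_eq_zero_of_mem hxj
        linarith
    -- An endpoint with `S + T < 1` would lie outside the angle, since the triangle holds no further
    -- vertex, and the side would cross a leg.
    have caseA : ∀ m, 2 ≤ m → m ≤ n → f m ∈ segment ℝ (f j) (f (j + 1)) →
        1 ≤ S (f m) + T (f m) := by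
      intro m hm2 hmn hm
      by_contra! hlt
      rcases hm2.eq_or_lt with rfl | hm2
      · rw [hST.fst_right, hST.snd_right] at hlt; linarith
      rcases hmn.eq_or_lt with rfl | hmn
      · rw [hn0, hST.fst_left, hST.snd_left] at hlt; linarith
      exact hf.not_leave_angle hST hj2 hj hxj hm (by linarith) (by linarith) (by linarith) hlt
        (hout m hm2 hmn hlt.le)
    have a1 := caseA j hj2 hj.le (left_mem_segment _ _ _)
    have a2 := caseA (j + 1) (by omega) hj (right_mem_segment _ _ _)
    -- A vertex on the line through `f 0` and `f 2` is not strictly between them. As `S + T` equals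
    -- `1` at `x` and is at least `1` at both ends, the side must then lie on this line.
    have caseB : ∀ m, 2 ≤ m → m ≤ n → S (f m) + T (f m) = 1 → S (f m) ≤ 0 ∨ 1 ≤ S (f m) := by
      intro m hm2 hmn heq
      rcases hm2.eq_or_lt with rfl | hm2
      · rw [hST.fst_right]; simp
      rcases hmn.eq_or_lt with rfl | hmn
      · rw [hn0, hST.fst_left]; simp
      rcases hout m hm2 hmn heq.le with h | h
      · exact Or.inl h.le
      · exact Or.inr (by linarith)
    obtain ⟨ρ, hρ, hxρ⟩ := mem_segment_iff_exists.1 hxj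
    have b1 := congrArg S hxρ
    have b2 := congrArg T hxρ
    rw [hST.fst_line, hSx] at b1
    rw [hST.snd_line, hTx] at b2
    have c1 : S (f j) + T (f j) = 1 := by
      by_contra hcon
      have h1 : 1 < S (f j) + T (f j) := lt_of_le_of_ne a1 (Ne.symm hcon)
      have h2 : ρ = 1 := by
        by_contra hρ1
        have : ρ < 1 := lt_of_le_of_ne hρ.2 hρ1
        have := mul_pos (sub_pos.2 this) (sub_pos.2 h1)
        have := mul_nonneg hρ.1 (sub_nonneg.2 a2)
        linarith
      rw [h2] at b1 b2
      rcases caseB (j + 1) (by omega) hj (by linarith) with h | h <;> linarith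
    have c2 : S (f (j + 1)) + T (f (j + 1)) = 1 := by
      by_contra hcon
      have h1 : 1 < S (f (j + 1)) + T (f (j + 1)) := lt_of_le_of_ne a2 (Ne.symm hcon)
      have h2 : ρ = 0 := by
        by_contra hρ1
        have : 0 < ρ := lt_of_le_of_ne hρ.1 (Ne.symm hρ1)
        have := mul_pos this (sub_pos.2 h1)
        have := mul_nonneg (sub_nonneg.2 hρ.2) (sub_nonneg.2 a1)
        linarith
      rw [h2] at b1 b2
      rcases caseB j hj2 hj.le c1 with h | h <;> linarith
    -- The side covers the whole chord, hence contains both `f 0` and `f 2`; simplicity makes it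
    -- adjacent to both legs, which forces `n = 3`.
    have hline : ∀ c : ℝ, 0 ≤ c → c ≤ 1 → ∃ z ∈ segment ℝ (f j) (f (j + 1)), S z = c ∧
        T z = 1 - c := by
      intro c h0 h1
      have : c ∈ uIcc (S (f j)) (S (f (j + 1))) := by
        rw [mem_uIcc]
        rcases caseB j hj2 hj.le c1 with h | h <;>
          rcases caseB (j + 1) (by omega) hj c2 with h' | h'
        · nlinarith [hρ.1, hρ.2]
        · exact Or.inl ⟨by linarith, by linarith⟩
        · exact Or.inr ⟨by linarith, by linarith⟩
        · nlinarith [hρ.1, hρ.2]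
      rw [← segment_eq_uIcc, segment_eq_image'] at this
      obtain ⟨θ, hθ, e⟩ := this
      simp only [smul_eq_mul] at e
      refine ⟨_, mem_segment_iff_exists.2 ⟨θ, hθ, rfl⟩, ?_, ?_⟩
      · rw [hST.fst_line, ← e]
      · rw [hST.snd_line, ← e]
        linear_combination (1 - θ) * c1 + θ * c2
    obtain ⟨z, hz, z1, z2⟩ := hline 0 le_rfl zero_le_one
    have ez : z = f 2 := hST.ext (by rw [z1, hST.fst_right]) (by rw [z2, hST.snd_right, sub_zero])
    obtain ⟨z', hz', z1', z2'⟩ := hline 1 zero_le_one le_rfl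
    have ez' : z' = f 0 := hST.ext (by rw [z1', hST.fst_left]) (by rw [z2', hST.snd_left, sub_self])
    rw [ez] at hz
    rw [ez'] at hz'
    rcases hf.inter 1 j _ (by omega) (by omega) (right_mem_segment _ _ _) hz with ⟨h, -⟩ | ⟨h, -⟩
    · rcases hf.inter 0 j _ (by omega) (by omega) (left_mem_segment _ _ _) hz' with ⟨h, -⟩ | ⟨h, -⟩
      · omega
      · omega
    · omega
  · obtain ⟨k, hkU, hmin⟩ := U.exists_min_image (fun k => S (f k) + T (f k)) hne
    obtain ⟨⟨hk3, hkn⟩, hS0, hT0, hle⟩ := (hmem k).1 hkU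
    have hSp : 0 < S (f k) := by
      refine lt_of_le_of_ne hS0 fun h => ?_
      rcases hf.inter 1 k (f k) (by omega) (by omega) (hST.mem_right h.symm hT0 (by linarith))
        (left_mem_segment _ _ _) with ⟨e, -⟩ | ⟨e, -⟩ <;> omega
    have hTp : 0 < T (f k) := by
      refine lt_of_le_of_ne hT0 fun h => ?_
      rcases hf.inter 0 k (f k) (by omega) (by omega) (hST.mem_left h.symm hS0 (by linarith))
        (left_mem_segment _ _ _) with ⟨e, -⟩ | ⟨e, e'⟩
      · omega
      · refine hf.ne k ?_
        rw [e', e, zero_add, hn0]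
    have hk1 : 1 + (k - 1) = k := by omega
    refine ⟨1, k - 1, by omega, by omega, fun h => ?_, ?_⟩
    · rw [hk1] at h
      rw [← h, hST.fst_origin] at hSp
      exact lt_irrefl _ hSp
    rw [hk1]
    rintro x ⟨hx, hxt⟩
    obtain ⟨τ, hτ, rfl⟩ := mem_segment_iff_exists.1 hx
    rcases hτ.1.lt_or_eq with hτ0 | rfl
    swap
    · simp
    rcases hτ.2.lt_or_eq with hτ1 | rfl
    swap
    · simp
    exfalso
    have hSx : S (f 1 + τ • (f k - f 1)) = τ * S (f k) := by
      rw [hST.fst_line, hST.fst_origin]; ring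
    have hTx : T (f 1 + τ • (f k - f 1)) = τ * T (f k) := by
      rw [hST.snd_line, hST.snd_origin]; ring
    generalize f 1 + τ • (f k - f 1) = x at *
    have hSxp : 0 < S x := by rw [hSx]; positivity
    have hTxp : 0 < T x := by rw [hTx]; positivity
    have hhx : S x + T x < S (f k) + T (f k) := by rw [hSx, hTx]; nlinarith
    obtain ⟨j, -, hj, hxj⟩ := exists_lt_of_mem_trace hf.periodic hf.pos 0 hxt
    rw [zero_add] at hj
    have hj2 : 2 ≤ j := by
      by_contra hj2
      have : j = 0 ∨ j = 1 := by omega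
      rcases this with rfl | rfl
      · have := hST.snd_eq_zero_of_mem hxj
        linarith
      · have := hST.fst_eq_zero_of_mem hxj
        linarith
    -- A lower endpoint would either contradict the minimality of `k` or make the side leave the
    -- angle. With both ends strictly higher than `x`, the affine function `S + T` cannot take its
    -- value at `x` on the side.
    have caseA : ∀ m, 2 ≤ m → m ≤ n → f m ∈ segment ℝ (f j) (f (j + 1)) →
        S x + T x < S (f m) + T (f m) := by
      intro m hm2 hmn hm
      by_contra! hlt
      rcases hm2.eq_or_lt with rfl | hm2
      · rw [hST.fst_right, hST.snd_right] at hlt; linarith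
      rcases hmn.eq_or_lt with rfl | hmn
      · rw [hn0, hST.fst_left, hST.snd_left] at hlt; linarith
      refine hf.not_leave_angle hST hj2 hj hxj hm hSxp hTxp (by linarith) (by linarith) ?_
      by_contra! hcon
      have := hmin m ((hmem m).2 ⟨⟨hm2, hmn⟩, hcon.1, hcon.2, by linarith⟩)
      linarith
    have a1 := caseA j hj2 hj.le (left_mem_segment _ _ _)
    have a2 := caseA (j + 1) (by omega) hj (right_mem_segment _ _ _)
    obtain ⟨ρ, hρ, hxρ⟩ := mem_segment_iff_exists.1 hxj
    have b1 := congrArg S hxρ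
    have b2 := congrArg T hxρ
    rw [hST.fst_line] at b1
    rw [hST.snd_line] at b2
    obtain ⟨hρ0, hρ1⟩ := hρ
    rcases hρ0.eq_or_lt with rfl | hρ0
    · linarith
    · nlinarith

/-- Renumbering puts a vertex with a genuine turn at index `1`, where affine coordinates exist. -/
theorem exists_chord (hf : SimpleChain n f) (hn : 4 ≤ n) :
    ∃ a k, 2 ≤ k ∧ k + 2 ≤ n ∧ f a ≠ f (a + k) ∧
      segment ℝ (f a) (f (a + k)) ∩ trace f ⊆ {f a, f (a + k)} := by
  obtain ⟨i, hi⟩ := hf.exists_cross_ne_zero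
  obtain ⟨S, T, hST⟩ := exists_affineCoords (v := f (i + 1)) (a := f i) (b := f (i + 2)) (by
    convert neg_ne_zero.2 hi using 1
    simp [cross]; ring)
  have e := hf.trace_shift i
  obtain ⟨a, k, h1, h2, h3, h4⟩ := (hf.shift i).exists_chord_of_coords hn (S := S) (T := T) (by
    simpa [add_comm i] using hST)
  refine ⟨a + i, k, h1, h2, ?_, ?_⟩
  · rw [add_right_comm]; exact h3
  · rw [e] at h4
    rw [add_right_comm]; exact h4

end SimpleChain
end LatticePolygon

/-! ### Pick's formula for triangles, and the induction -/

namespace LatticePolygon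
open Filter Topology Set

/-- The lattice point at the lower left of `x`. -/
noncomputable def latticeFloor (x : ℝ × ℝ) : ℝ × ℝ := ((⌊x.1⌋ : ℝ), (⌊x.2⌋ : ℝ))

theorem latticeFloor_mem (x : ℝ × ℝ) : latticeFloor x ∈ lattice := ⟨(⌊x.1⌋, ⌊x.2⌋), rfl⟩

theorem measurable_latticeFloor : Measurable latticeFloor := by
  unfold latticeFloor
  fun_prop

theorem latticeFloor_add {l : ℝ × ℝ} (hl : l ∈ lattice) (x : ℝ × ℝ) :
    latticeFloor (l + x) = l + latticeFloor x := by
  obtain ⟨z, rfl⟩ := hl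
  simp [latticeFloor]

theorem volume_latticeFloor_preimage {p : ℝ × ℝ} (hp : p ∈ lattice) :
    volume (latticeFloor ⁻¹' {p}) = 1 := by
  obtain ⟨z, rfl⟩ := hp
  have : latticeFloor ⁻¹' {((z.1 : ℝ), (z.2 : ℝ))} =
      Ico (z.1 : ℝ) (z.1 + 1) ×ˢ Ico (z.2 : ℝ) (z.2 + 1) := by
    ext x
    simp [latticeFloor, Prod.ext_iff, Int.floor_eq_iff]
  rw [this, Measure.volume_eq_prod, Measure.prod_prod]
  simp

theorem add_mem_lattice {x y : ℝ × ℝ} (hx : x ∈ lattice) (hy : y ∈ lattice) : x + y ∈ lattice := by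
  obtain ⟨z, rfl⟩ := hx
  obtain ⟨w, rfl⟩ := hy
  exact ⟨z + w, by simp⟩

theorem sub_mem_lattice {x y : ℝ × ℝ} (hx : x ∈ lattice) (hy : y ∈ lattice) : x - y ∈ lattice := by
  obtain ⟨z, rfl⟩ := hx
  obtain ⟨w, rfl⟩ := hy
  exact ⟨z - w, by simp⟩

theorem zsmul_mem_lattice {x : ℝ × ℝ} (hx : x ∈ lattice) (m : ℤ) : (m : ℝ) • x ∈ lattice := by
  obtain ⟨z, rfl⟩ := hx
  exact ⟨m • z, by simp⟩

/-- The volume of the points whose lower left lattice point lies in a bounded set. -/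
theorem volume_latticeFloor_preimage_eq {D : Set (ℝ × ℝ)} (hD : Bornology.IsBounded D) :
    volume (latticeFloor ⁻¹' D) = (lattice ∩ D).ncard := by
  have hfin := finite_lattice_inter hD
  have : latticeFloor ⁻¹' D = ⋃ p ∈ hfin.toFinset, latticeFloor ⁻¹' {p} := by
    ext x
    simp [latticeFloor_mem]
  rw [this, measure_biUnion_finset]
  · rw [Finset.sum_congr rfl fun p hp => volume_latticeFloor_preimage
      ((hfin.mem_toFinset.1 hp).1)]
    simp [ncard_eq_toFinset_card _ hfin]
  · intro p _ q _ hpq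
    exact Disjoint.preimage _ (disjoint_singleton.2 hpq)
  · intro p _
    exact measurable_latticeFloor (measurableSet_singleton p)

namespace AffineCoords
variable {v a b : ℝ × ℝ} {S T : ℝ × ℝ → ℝ}

/-- The lattice of translations generated by the two coordinate vectors. -/
noncomputable def translations (v a b : ℝ × ℝ) : AddSubgroup (ℝ × ℝ) :=
  (AddMonoidHom.mk' (fun z : ℤ × ℤ => (z.1 : ℝ) • (a - v) + (z.2 : ℝ) • (b - v)) fun z w => by
    simp only [Prod.fst_add, Prod.snd_add, Int.cast_add, add_smul]; abel).range

theorem existsUnique_translation (h : AffineCoords v a b S T) (x : ℝ × ℝ) :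
    ∃! l : translations v a b, 0 ≤ S (l + x) ∧ S (l + x) < 1 ∧ 0 ≤ T (l + x) ∧ T (l + x) < 1 := by
  have key : ∀ z : ℤ × ℤ, S ((z.1 : ℝ) • (a - v) + (z.2 : ℝ) • (b - v) + x) = S x + z.1 ∧
      T ((z.1 : ℝ) • (a - v) + (z.2 : ℝ) • (b - v) + x) = T x + z.2 := fun z => by
    rw [add_comm, ← add_assoc, h.fst_add, h.snd_add]
    exact ⟨rfl, rfl⟩
  refine ⟨⟨_, (-⌊S x⌋, -⌊T x⌋), rfl⟩, ?_, ?_⟩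
  · have k := key (-⌊S x⌋, -⌊T x⌋)
    simp only [AddMonoidHom.mk'_apply]
    rw [k.1, k.2]
    have h1 := Int.floor_le (S x)
    have h2 := Int.lt_floor_add_one (S x)
    have h3 := Int.floor_le (T x)
    have h4 := Int.lt_floor_add_one (T x)
    push_cast
    refine ⟨?_, ?_, ?_, ?_⟩ <;> linarith
  · rintro ⟨_, z, rfl⟩ hz
    simp only [AddMonoidHom.mk'_apply] at hz
    rw [(key z).1, (key z).2] at hz
    have e1 : ⌊S x⌋ = -z.1 := Int.floor_eq_iff.2 ⟨by push_cast; linarith, by push_cast; linarith⟩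
    have e2 : ⌊T x⌋ = -z.2 := Int.floor_eq_iff.2 ⟨by push_cast; linarith, by push_cast; linarith⟩
    simp [e1, e2]

/-- The half-open parallelogram spanned by the coordinate vectors. -/
def parallelogram (S T : ℝ × ℝ → ℝ) : Set (ℝ × ℝ) :=
  {x | 0 ≤ S x ∧ S x < 1 ∧ 0 ≤ T x ∧ T x < 1}

theorem isBounded_of_le_one (h : AffineCoords v a b S T) {D : Set (ℝ × ℝ)}
    (hD : ∀ x ∈ D, 0 ≤ S x ∧ S x ≤ 1 ∧ 0 ≤ T x ∧ T x ≤ 1) : Bornology.IsBounded D := by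
  refine (Metric.isBounded_closedBall (x := (0 : ℝ × ℝ))
    (r := ‖v‖ + ‖a - v‖ + ‖b - v‖)).subset fun x hx => ?_
  obtain ⟨h1, h2, h3, h4⟩ := hD x hx
  rw [mem_closedBall_zero_iff, h.eq x]
  refine (norm_add₃_le).trans ?_
  rw [norm_smul, norm_smul, Real.norm_of_nonneg h1, Real.norm_of_nonneg h3]
  gcongr
  · exact mul_le_of_le_one_left (norm_nonneg _) h2
  · exact mul_le_of_le_one_left (norm_nonneg _) h4

theorem measurableSet_parallelogram (h : AffineCoords v a b S T) :
    MeasurableSet (parallelogram S T) := by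
  have hS := h.continuous_fst.measurable
  have hT := h.continuous_snd.measurable
  exact (measurableSet_le measurable_const hS).inter ((measurableSet_lt hS measurable_const).inter
    ((measurableSet_le measurable_const hT).inter (measurableSet_lt hT measurable_const)))

/-- The area of a half-open lattice parallelogram is the number of its lattice points. -/
theorem volume_parallelogram (h : AffineCoords v a b S T) (hv : v ∈ lattice) (ha : a ∈ lattice)
    (hb : b ∈ lattice) : volume.real (parallelogram S T) = latticeCount (parallelogram S T) := by
  have hl : ∀ l : translations v a b, (l : ℝ × ℝ) ∈ lattice := by
    rintro ⟨_, z, rfl⟩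
    exact add_mem_lattice (zsmul_mem_lattice (sub_mem_lattice ha hv) _)
      (zsmul_mem_lattice (sub_mem_lattice hb hv) _)
  have hD : IsAddFundamentalDomain (translations v a b) (parallelogram S T) volume :=
    .mk' h.measurableSet_parallelogram.nullMeasurableSet h.existsUnique_translation
  -- The union of the unit squares whose lower left corner is in the parallelogram is a second
  -- fundamental domain of the same group, because the translations are lattice vectors and commute
  -- with `latticeFloor`. Both domains have the same area.
  have hU : IsAddFundamentalDomain (translations v a b) (latticeFloor ⁻¹' parallelogram S T)
      volume := by
    refine .mk' (measurable_latticeFloor h.measurableSet_parallelogram).nullMeasurableSet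
      fun x => ?_
    convert h.existsUnique_translation (latticeFloor x) using 2 with l
    rw [mem_preimage, AddSubgroup.vadd_def, vadd_eq_add, latticeFloor_add (hl l)]
    rfl
  have : Countable (translations v a b) := (Set.countable_range _).to_subtype
  unfold latticeCount Measure.real
  rw [hD.measure_eq hU, volume_latticeFloor_preimage_eq
    (h.isBounded_of_le_one fun x hx => ⟨hx.1, hx.2.1.le, hx.2.2.1, hx.2.2.2.le⟩)]
  simp

/-- The sides of the triangle with vertices `v`, `a`, `b`. -/
def sides (v a b : ℝ × ℝ) : Set (ℝ × ℝ) := segment ℝ v a ∪ segment ℝ v b ∪ segment ℝ a b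

/-- The interior of the coordinate triangle. -/
def openTriangle (S T : ℝ × ℝ → ℝ) : Set (ℝ × ℝ) := {x | 0 < S x ∧ 0 < T x ∧ S x + T x < 1}

theorem mem_sides (h : AffineCoords v a b S T) {x : ℝ × ℝ} :
    x ∈ sides v a b ↔ 0 ≤ S x ∧ 0 ≤ T x ∧ S x + T x ≤ 1 ∧ (S x = 0 ∨ T x = 0 ∨ S x + T x = 1) := by
  constructor
  · rintro ((hx | hx) | hx) <;> obtain ⟨t, ht, rfl⟩ := mem_segment_iff_exists.1 hx <;>
      rw [h.fst_line, h.snd_line] <;>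
      simp only [h.fst_left, h.snd_left, h.fst_right, h.snd_right, h.fst_origin, h.snd_origin]
    · exact ⟨by linarith [ht.1], by linarith, by linarith [ht.2], Or.inr (Or.inl (by ring))⟩
    · exact ⟨by linarith, by linarith [ht.1], by linarith [ht.2], Or.inl (by ring)⟩
    · exact ⟨by linarith [ht.2], by linarith [ht.1], by linarith, Or.inr (Or.inr (by ring))⟩
  · rintro ⟨h1, h2, h3, h4 | h4 | h4⟩
    · exact Or.inl (Or.inr (h.mem_right h4 h2 (by linarith)))
    · refine Or.inl (Or.inl ?_)
      rw [segment_symm]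
      exact h.mem_left h4 h1 (by linarith)
    · refine Or.inr (mem_segment_iff_exists.2 ⟨T x, ⟨h2, by linarith⟩, h.ext ?_ ?_⟩)
      · rw [h.fst_line, h.fst_left, h.fst_right]; linarith
      · rw [h.snd_line, h.snd_left, h.snd_right]; linarith

/-- The ray from `x` pointing away from `w` stays where `L` is negative, so it avoids `B` and makes
the component of `x` unbounded. -/
theorem _root_.LatticePolygon.notMem_enclosed_of_separated {B : Set (ℝ × ℝ)} {L : ℝ × ℝ → ℝ}
    (hL : ∀ p q (τ : ℝ), L (p + τ • (q - p)) = L p + τ * (L q - L p)) (hB : ∀ y ∈ B, 0 ≤ L y)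
    {x w : ℝ × ℝ} (hx : L x < 0) (hw : 0 ≤ L w) : x ∉ enclosed B := by
  rintro ⟨-, hb⟩
  have hsub : (fun τ : ℝ => w + τ • (x - w)) '' Ici 1 ⊆ Bᶜ := by
    rintro _ ⟨τ, hτ, rfl⟩ hmem
    have h1 := hB _ hmem
    simp only [hL] at h1
    have hτ : 1 ≤ τ := hτ
    nlinarith
  have hray : (fun τ : ℝ => w + τ • (x - w)) '' Ici 1 ⊆ connectedComponentIn Bᶜ x :=
    (isPreconnected_Ici.image _ (by fun_prop)).subset_connectedComponentIn
      ⟨1, mem_Ici.2 le_rfl, by simp⟩ hsub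
  obtain ⟨M, hM⟩ := (hb.subset hray).exists_norm_le
  have hne : 0 < ‖x - w‖ := norm_pos_iff.2 (sub_ne_zero.2 (by rintro rfl; linarith))
  have hM0 : 0 ≤ M := (norm_nonneg _).trans (hM _ ⟨1, mem_Ici.2 le_rfl, rfl⟩)
  -- At this parameter the point of the ray has norm greater than `M`.
  set τ := (M + ‖w‖) / ‖x - w‖ + 1 with hτ
  have hτ1 : 1 ≤ τ := by rw [hτ]; linarith [show 0 ≤ (M + ‖w‖) / ‖x - w‖ by positivity]
  have h1 := hM _ ⟨τ, mem_Ici.2 hτ1, rfl⟩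
  have h2 : ‖τ • (x - w)‖ ≤ ‖w + τ • (x - w)‖ + ‖w‖ := by
    simpa using norm_sub_le (w + τ • (x - w)) w
  rw [norm_smul, Real.norm_of_nonneg (by linarith), hτ, add_mul, div_mul_cancel₀ _ hne.ne'] at h2
  simp only [← hτ] at h2
  linarith

theorem enclosed_sides (h : AffineCoords v a b S T) : enclosed (sides v a b) = openTriangle S T := by
  have hS := h.continuous_fst
  have hT := h.continuous_snd
  have hR : ∀ p q (τ : ℝ), 1 - S (p + τ • (q - p)) - T (p + τ • (q - p)) =
      1 - S p - T p + τ * ((1 - S q - T q) - (1 - S p - T p)) := fun p q τ => by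
    rw [h.fst_line, h.snd_line]; ring
  refine Subset.antisymm (fun x hx => ?_) fun x hx => ?_
  · by_contra hn
    have hn' : S x < 0 ∨ T x < 0 ∨ 1 - S x - T x < 0 := by
      by_contra! hc
      by_cases hB : S x = 0 ∨ T x = 0 ∨ S x + T x = 1
      · exact hx.1 (h.mem_sides.2 ⟨hc.1, hc.2.1, by linarith, hB⟩)
      · push Not at hB
        exact hn ⟨lt_of_le_of_ne hc.1 hB.1.symm, lt_of_le_of_ne hc.2.1 hB.2.1.symm,
          lt_of_le_of_ne (by linarith) hB.2.2⟩
    rcases hn' with hlt | hlt | hlt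
    · exact notMem_enclosed_of_separated (w := v) h.fst_line (fun y hy => (h.mem_sides.1 hy).1) hlt
        h.fst_origin.ge hx
    · exact notMem_enclosed_of_separated (w := v) h.snd_line (fun y hy => (h.mem_sides.1 hy).2.1) hlt
        h.snd_origin.ge hx
    · exact notMem_enclosed_of_separated (w := v) (L := fun x => 1 - S x - T x) hR
        (fun y hy => by linarith [(h.mem_sides.1 hy).2.2.1]) hlt
        (by rw [h.fst_origin, h.snd_origin]; norm_num) hx
  · have hxB : x ∉ sides v a b := fun hm => by
      obtain ⟨-, -, -, h0 | h0 | h0⟩ := h.mem_sides.1 hm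
      · exact hx.1.ne' h0
      · exact hx.2.1.ne' h0
      · exact hx.2.2.ne h0
    refine ⟨hxB, Bornology.IsBounded.subset (h.isBounded_of_le_one (D := openTriangle S T)
      fun y hy => ⟨hy.1.le, by linarith [hy.2.1, hy.2.2], hy.2.1.le,
        by linarith [hy.1, hy.2.2]⟩) ?_⟩
    have o1 : IsOpen (openTriangle S T) :=
      (isOpen_lt continuous_const hS).inter ((isOpen_lt continuous_const hT).inter
        (isOpen_lt (hS.add hT) continuous_const))
    -- The open triangle and this open exterior are disjoint and cover the complement of the sides,
    -- so the component of `x` cannot leave the triangle.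
    have o2 : IsOpen ({y | S y < 0} ∪ ({y | T y < 0} ∪ {y | 1 < S y + T y})) :=
      (isOpen_lt hS continuous_const).union ((isOpen_lt hT continuous_const).union
        (isOpen_lt continuous_const (hS.add hT)))
    refine isPreconnected_connectedComponentIn.subset_left_of_subset_union o1 o2 ?_ ?_
      ⟨x, mem_connectedComponentIn hxB, hx⟩
    · rw [Set.disjoint_left]
      rintro y ⟨h1, h2, h3⟩ (h4 | h4 | h4) <;> simp only [mem_ofPred_eq] at h4 <;> linarith
    · refine (connectedComponentIn_subset _ _).trans fun y hy => ?_
      by_contra hcon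
      simp only [mem_union, not_or, mem_ofPred_eq, not_lt] at hcon
      obtain ⟨c1, c2, c3, c4⟩ := hcon
      refine hy (h.mem_sides.2 ⟨c2, c3, c4, ?_⟩)
      by_contra! hB
      exact c1 ⟨lt_of_le_of_ne c2 hB.1.symm, lt_of_le_of_ne c3 hB.2.1.symm, lt_of_le_of_ne c4 hB.2.2⟩

/-- The half turn about the centre of the coordinate parallelogram. -/
theorem reflect (h : AffineCoords v a b S T) (x : ℝ × ℝ) :
    S (a + b - x) = 1 - S x ∧ T (a + b - x) = 1 - T x := by
  have e : a + b - x = v + (1 - S x) • (a - v) + (1 - T x) • (b - v) := by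
    conv_lhs => rw [h.eq x]
    rw [sub_smul, sub_smul, one_smul, one_smul]; abel
  rw [e, h.fst_add, h.snd_add, h.fst_origin, h.snd_origin]
  simp

/-- The half-open parallelogram consists of the open triangle, its image under the half turn, and
the sides without `a` and `b`. Equating area and lattice count, twice the area of the triangle is
twice its interior count plus its boundary count minus two. -/
theorem pickDefect_sides (h : AffineCoords v a b S T) (hv : v ∈ lattice) (ha : a ∈ lattice)
    (hb : b ∈ lattice) : pickDefect (sides v a b) = 0 := by
  set T' := (fun x => a + b - x) ⁻¹' openTriangle S T with hT'
  have hmemT' : ∀ x, x ∈ T' ↔ S x < 1 ∧ T x < 1 ∧ 1 < S x + T x := fun x => by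
    rw [hT', mem_preimage, openTriangle, mem_ofPred_eq, (h.reflect x).1, (h.reflect x).2]
    constructor
    · rintro ⟨h1, h2, h3⟩; exact ⟨by linarith, by linarith, by linarith⟩
    · rintro ⟨h1, h2, h3⟩; exact ⟨by linarith, by linarith, by linarith⟩
  have hab : a ≠ b := by
    rintro rfl
    have := h.fst_left
    rw [h.fst_right] at this
    norm_num at this
  have bB : Bornology.IsBounded (sides v a b \ {a, b}) := h.isBounded_of_le_one fun x hx => by
    obtain ⟨h1, h2, h3, -⟩ := h.mem_sides.1 hx.1
    exact ⟨h1, by linarith, h2, by linarith⟩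
  have bT : Bornology.IsBounded (openTriangle S T) := h.isBounded_of_le_one
    fun y hy => ⟨hy.1.le, by linarith [hy.2.1, hy.2.2], hy.2.1.le, by linarith [hy.1, hy.2.2]⟩
  have bT' : Bornology.IsBounded T' := h.isBounded_of_le_one fun y hy => by
    obtain ⟨h1, h2, h3⟩ := (hmemT' y).1 hy
    exact ⟨by linarith, by linarith, by linarith, by linarith⟩
  have dTT : Disjoint (openTriangle S T) T' := by
    rw [Set.disjoint_left]
    intro x hx hx'
    linarith [hx.2.2, ((hmemT' x).1 hx').2.2]
  have dTB : Disjoint (openTriangle S T ∪ T') (sides v a b \ {a, b}) := by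
    rw [Set.disjoint_left]
    rintro x hx ⟨hx', -⟩
    obtain ⟨h1, h2, h3, h4⟩ := h.mem_sides.1 hx'
    rcases hx with hx | hx
    · rcases h4 with h4 | h4 | h4
      · exact hx.1.ne' h4
      · exact hx.2.1.ne' h4
      · exact hx.2.2.ne h4
    · linarith [((hmemT' x).1 hx).2.2]
  have hD : parallelogram S T = openTriangle S T ∪ T' ∪ sides v a b \ {a, b} := by
    have hxa : ∀ x, x = a ↔ S x = 1 ∧ T x = 0 := fun x =>
      ⟨fun e => e ▸ ⟨h.fst_left, h.snd_left⟩,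
        fun e => h.ext (by rw [e.1, h.fst_left]) (by rw [e.2, h.snd_left])⟩
    have hxb : ∀ x, x = b ↔ S x = 0 ∧ T x = 1 := fun x =>
      ⟨fun e => e ▸ ⟨h.fst_right, h.snd_right⟩,
        fun e => h.ext (by rw [e.1, h.fst_right]) (by rw [e.2, h.snd_right])⟩
    ext x
    have hs : x ∈ sides v a b \ {a, b} ↔ x ∈ sides v a b ∧ ¬ (x = a ∨ x = b) := Iff.rfl
    rw [mem_union, mem_union, hmemT', hs, h.mem_sides, hxa, hxb]
    constructor
    · rintro ⟨h1, h2, h3, h4⟩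
      by_cases hB : S x = 0 ∨ T x = 0 ∨ S x + T x = 1
      · refine Or.inr ⟨⟨h1, h3, ?_, hB⟩, ?_⟩
        · rcases hB with e | e | e <;> linarith
        · rintro (⟨e, -⟩ | ⟨-, e⟩) <;> linarith
      · push Not at hB
        rcases lt_or_gt_of_ne hB.2.2 with e | e
        · exact Or.inl (Or.inl ⟨lt_of_le_of_ne h1 hB.1.symm, lt_of_le_of_ne h3 hB.2.1.symm, e⟩)
        · exact Or.inl (Or.inr ⟨h2, h4, e⟩)
    · rintro ((⟨h1, h2, h3⟩ | ⟨h1, h2, h3⟩) | ⟨⟨h1, h2, h3, -⟩, h4⟩)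
      · exact ⟨h1.le, by linarith, h2.le, by linarith⟩
      · exact ⟨by linarith, h1, by linarith, h2⟩
      · rw [not_or] at h4
        refine ⟨h1, ?_, h2, ?_⟩
        · by_contra hc
          exact h4.1 ⟨by linarith, by linarith⟩
        · by_contra hc
          exact h4.2 ⟨by linarith, by linarith⟩
  have cT' : latticeCount T' = latticeCount (openTriangle S T) := by
    unfold latticeCount
    congr 1
    have hinj : Function.Injective fun x : ℝ × ℝ => a + b - x := fun x y hxy => by
      simpa using hxy
    rw [← ncard_image_of_injective _ hinj]
    congr 1
    ext x
    constructor
    · rintro ⟨y, ⟨hy, hyT⟩, rfl⟩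
      exact ⟨sub_mem_lattice (add_mem_lattice ha hb) hy, hyT⟩
    · rintro ⟨hx, hxT⟩
      refine ⟨a + b - x, ⟨sub_mem_lattice (add_mem_lattice ha hb) hx, ?_⟩, by simp⟩
      rw [hT', mem_preimage, sub_sub_cancel]
      exact hxT
  have oT : IsOpen (openTriangle S T) :=
    (isOpen_lt continuous_const h.continuous_fst).inter
      ((isOpen_lt continuous_const h.continuous_snd).inter
        (isOpen_lt (h.continuous_fst.add h.continuous_snd) continuous_const))
  have vT' : volume T' = volume (openTriangle S T) :=
    (Measure.measurePreserving_sub_left volume (a + b)).measure_preimage oT.measurableSet.nullMeasurableSet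
  have nB : volume (sides v a b) = 0 := measure_union_null
    (measure_union_null (volume_segment_eq_zero _ _) (volume_segment_eq_zero _ _))
    (volume_segment_eq_zero _ _)
  have cB : latticeCount (sides v a b) = latticeCount (sides v a b \ {a, b}) + 2 := by
    rw [← latticeCount_pair ha hb hab, ← latticeCount_union bB (toFinite _).isBounded
      disjoint_sdiff_left, sdiff_union_of_subset]
    rintro x (rfl | rfl)
    · exact Or.inr (left_mem_segment _ _ _)
    · exact Or.inr (right_mem_segment _ _ _)
  have hcount := h.volume_parallelogram hv ha hb
  rw [hD, latticeCount_union (bT.union bT') bB dTB, latticeCount_union bT bT' dTT, cT'] at hcount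
  unfold Measure.real at hcount
  rw [volume_union_of_null (measure_mono_null sdiff_subset nB),
    measure_union' dTT oT.measurableSet, vT', ENNReal.toReal_add bT.measure_lt_top.ne
    bT.measure_lt_top.ne] at hcount
  unfold pickDefect Measure.real
  rw [union_comm, volume_union_of_null nB, h.enclosed_sides, cB]
  linarith

end AffineCoords

/-- Strong induction on the number of sides: the chord splits `n` sides into chains with `k + 1` and
`n - k + 1` sides, both fewer than `n` as `2 ≤ k ≤ n - 2`. -/
theorem SimpleChain.pickDefect_eq_zero {n : ℕ} {f : ℕ → ℝ × ℝ} (hf : SimpleChain n f)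
    (hl : ∀ i, f i ∈ lattice) : pickDefect (trace f) = 0 := by
  induction n using Nat.strong_induction_on generalizing f with
  | _ n ih =>
    rcases hf.three_le.eq_or_lt with rfl | hn
    · obtain ⟨i, hi⟩ := hf.exists_cross_ne_zero
      obtain ⟨S, T, hST⟩ := exists_affineCoords (v := f (i + 1)) (a := f i) (b := f (i + 2)) (by
        -- The coordinate vector towards `f i` is the reversed incoming side, hence the sign.
        convert neg_ne_zero.2 hi using 1
        simp [cross]; ring)
      have e : trace f = AffineCoords.sides (f (i + 1)) (f i) (f (i + 2)) := by
        rw [← hf.trace_shift i, trace_eq_biUnion (hf.shift i).periodic hf.pos]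
        simp only [Finset.set_biUnion_insert, Finset.range_add_one, Finset.range_zero,
          Finset.notMem_empty, iUnion_false, iUnion_empty, union_empty, AffineCoords.sides]
        have e3 : f (2 + 1 + i) = f i := by rw [← hf.periodic i]; congr 1; omega
        rw [e3, segment_symm ℝ (f (0 + i))]
        simp only [zero_add, add_comm 1 i, add_comm 2 i]
        rw [segment_symm ℝ (f (i + 2))]
        ac_rfl
      rw [e]
      exact hST.pickDefect_sides (hl _) (hl _) (hl _)
    · obtain ⟨a, k, h2, hk, hne, hc⟩ := hf.exists_chord hn
      have hg := hf.shift a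
      rw [← hf.trace_shift a] at hc ⊢
      have e0 : f (0 + a) = f a := by rw [zero_add]
      have ek : f (k + a) = f (a + k) := by rw [add_comm]
      refine hg.pickDefect_eq_zero_of_chord h2 hk (hl _) (hl _) (by rwa [e0, ek])
        (by rwa [e0, ek]) ?_ ?_
      · refine ih (k + 1) (by omega) (hg.subchain (a := 0) h2 hk ?_ ?_) fun i => hl _
        · simpa [e0, ek] using hne
        · simpa [e0, ek] using hc
      · have en : f (k + (n - k) + a) = f a := by
          rw [show k + (n - k) + a = a + n by omega, hf.periodic]
        refine ih (n - k + 1) (by omega) (hg.subchain (a := k) (by omega) (by omega) ?_ ?_)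
          fun i => hl _
        · simpa [en, ek] using hne.symm
        · simp only [en, ek]
          rw [segment_symm, pair_comm]
          exact hc

end LatticePolygon

/-! ### From polygons to periodic chains -/

namespace LatticePolygon
open Set

/-- The vertices of a polygon, repeated periodically. -/
noncomputable def vertexSeq {n : ℕ} (P : Polygon (ℝ × ℝ) n) (hn : 0 < n) (i : ℕ) : ℝ × ℝ :=
  P ⟨i % n, Nat.mod_lt i hn⟩

variable {n : ℕ} {P : Polygon (ℝ × ℝ) n}

theorem finRotate_mk {i : ℕ} (hi : i < n) :
    finRotate n ⟨i, hi⟩ = ⟨(i + 1) % n, Nat.mod_lt _ (by omega)⟩ := by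
  obtain ⟨m, rfl⟩ : ∃ m, n = m + 1 := ⟨n - 1, by omega⟩
  rw [finRotate_apply]
  ext
  simp [Fin.val_add]

theorem vertexSeq_of_lt (hn : 0 < n) {i : ℕ} (hi : i < n) : vertexSeq P hn i = P ⟨i, hi⟩ := by
  simp [vertexSeq, Nat.mod_eq_of_lt hi]

theorem vertexSeq_succ (hn : 0 < n) {i : ℕ} (hi : i < n) :
    vertexSeq P hn (i + 1) = P (finRotate n ⟨i, hi⟩) := by
  rw [finRotate_mk]; rfl

theorem edgeSet_eq_segment (hn : 0 < n) {i : ℕ} (hi : i < n) :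
    P.edgeSet ℝ ⟨i, hi⟩ = segment ℝ (vertexSeq P hn i) (vertexSeq P hn (i + 1)) := by
  rw [Polygon.edgeSet, affineSegment_eq_segment, vertexSeq_of_lt hn hi, vertexSeq_succ hn hi]

theorem IsSimple.simpleChain (hP : IsSimple P) (hn : 0 < n) : SimpleChain n (vertexSeq P hn) := by
  have h3 := hP.three_le
  refine SimpleChain.of_lt h3 (fun i => by simp [vertexSeq]) (fun i hi => ?_)
    fun i j x hij hj hx1 hx2 => ?_
  · rw [vertexSeq_of_lt hn hi, vertexSeq_succ hn hi]
    exact hP.nondegenerate _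
  · have hi : i < n := by omega
    rw [← edgeSet_eq_segment hn hi] at hx1
    rw [← edgeSet_eq_segment hn hj] at hx2
    by_cases h1 : j = i + 1
    · have e : finRotate n ⟨i, hi⟩ = ⟨j, hj⟩ := by
        rw [finRotate_mk]; ext; simp [← h1, Nat.mod_eq_of_lt hj]
      have := hP.inter_next ⟨i, hi⟩
      rw [e] at this
      have hx : x ∈ ({P ⟨j, hj⟩} : Set (ℝ × ℝ)) := this ▸ ⟨hx1, hx2⟩
      exact Or.inl ⟨h1, by rw [vertexSeq_of_lt hn hj]; exact hx⟩
    · by_cases h2 : i = 0 ∧ j + 1 = n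
      · have e : finRotate n ⟨j, hj⟩ = ⟨i, hi⟩ := by
          rw [finRotate_mk]; ext; simp [h2.1, h2.2]
        have := hP.inter_next ⟨j, hj⟩
        rw [e] at this
        have hx : x ∈ ({P ⟨i, hi⟩} : Set (ℝ × ℝ)) := this ▸ ⟨hx2, hx1⟩
        exact Or.inr ⟨h2.1, h2.2, by
          rw [vertexSeq_of_lt hn (by omega)]; simpa [h2.1] using hx⟩
      · refine absurd hx2 (Set.disjoint_left.1 (hP.disjoint ⟨i, hi⟩ ⟨j, hj⟩ ?_ ?_ ?_) hx1)
        · simp [hij.ne]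
        · rw [finRotate_mk, ne_eq, Fin.mk.injEq, Nat.mod_eq_of_lt (by omega)]
          exact h1
        · rw [finRotate_mk, ne_eq, Fin.mk.injEq]
          rcases (show j + 1 ≤ n by omega).lt_or_eq with h | h
          · rw [Nat.mod_eq_of_lt h]; omega
          · rw [h, Nat.mod_self]; omega

theorem boundary_eq_trace (hn : 0 < n) : P.boundary ℝ = trace (vertexSeq P hn) := by
  rw [trace_eq_biUnion (n := n) (fun i => by simp [vertexSeq]) hn]
  ext x
  simp only [Polygon.boundary, mem_iUnion, Finset.mem_range, exists_prop]
  constructor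
  · rintro ⟨⟨i, hi⟩, hx⟩
    exact ⟨i, hi, edgeSet_eq_segment hn hi ▸ hx⟩
  · rintro ⟨i, hi, hx⟩
    exact ⟨⟨i, hi⟩, (edgeSet_eq_segment hn hi).symm ▸ hx⟩

end LatticePolygon

theorem mainTheorem1 {n : ℕ} (P : Polygon (ℝ × ℝ) n)
    (hlattice : LatticePolygon.IsLattice P) (hsimple : LatticePolygon.IsSimple P) :
    (LatticePolygon.boundaryPoints P).Finite ∧
      (LatticePolygon.interiorPoints P).Finite ∧
      volume (LatticePolygon.region P) ≠ ⊤ ∧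
      LatticePolygon.area P =
        (LatticePolygon.numBoundary P : ℝ) / 2 + (LatticePolygon.numInterior P : ℝ) - 1 := by
  have hn : 0 < n := by have := hsimple.three_le; omega
  have hf := hsimple.simpleChain hn
  have hJ := hf.jordanSet
  have hpick := hf.pickDefect_eq_zero fun i => hlattice _
  rw [← LatticePolygon.boundary_eq_trace hn] at hJ hpick
  refine ⟨LatticePolygon.finite_lattice_inter hJ.isCompact.isBounded,
    LatticePolygon.finite_lattice_inter hJ.isBounded_enclosed,
    (hJ.isCompact.isBounded.union hJ.isBounded_enclosed).measure_lt_top.ne, ?_⟩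
  -- By definition `inside P` is `enclosed (P.boundary ℝ)`, so the defect of the boundary unfolds to
  -- this expression.
  have h : LatticePolygon.area P - (LatticePolygon.numBoundary P : ℝ) / 2 -
      (LatticePolygon.numInterior P : ℝ) + 1 = 0 := hpick
  linarith
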